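/- Algorithms are deterministic programs for the word RAM: elementary instructions (constants, arithmetic, comparison, bitwise operations and shifts on words, indirect loads and stores, tests) cost one step each, the input is given as a sequence of words in memory, and words have $O(\log(N+T))$ bits, where $N$ is the input length in words and $T$ the time bound. Graphs are finite, simple, undirected and unweighted, and are given by lists of their edges. A set $S$ of vertices of $G=(V,E)$ is dominating if every $v\in V$ is in $S$ or has a neighbour in $S$; the $d$-dominating set problem asks, given $G$, whether $G$ has a dominating set of exactly $d$ vertices. For CNF formulas with $n$ variables and $m$ clauses, $O^*(2^{\delta n})$ means $O(2^{\delta n}\cdot\mathrm{poly}(n,m))$. Let $s_r$ be the infimum of all $\delta\ge 0$ such that $r$-SAT (clauses with at most $r$ literals) can be solved in $O^*(2^{\delta n})$ time. The strong exponential time hypothesis (SETH) states that $\lim_{r\to\infty}s_r=1$. **Theorem.** Let $\varepsilon>0$ be a constant, and suppose that there is an algorithm that, given an $m$-edge graph whose diameter is $2$ or $3$, decides in $O(m^{2-\varepsilon})$ time which of the two it is. Then: 1. for every integer $k\ge 2/\varepsilon$, the $2k$-dominating set problem on $n$-vertex graphs can be solved in $O(n^{2k-\varepsilon})$ time (the constant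 may depend on $k$ and $\varepsilon$); 2. the satisfiability of CNF formulas with $n$ variables and $m$ clauses can be decided in $O^*(2^{n(1-\varepsilon^2/4)})$ time; 3. SETH is false. -/

import Mathlib

open Filter Topology Asymptotics

/-! ## Word RAM programs and their running time -/

namespace WordRAM

/-- The unit-cost word operations (subtraction is truncated, division by zero gives zero,
comparisons give `0` or `1`). -/
inductive BinOp where
  | add | sub | mul | div | mod | land | lor | lxor | shl | shr | lt | eq

/-- Value of a word operation. -/
def BinOp.eval : BinOp → ℕ → ℕ → ℕ
  | .add, a, b => a + b
  | .sub, a, b => a - b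
  | .mul, a, b => a * b
  | .div, a, b => a / b
  | .mod, a, b => a % b
  | .land, a, b => a &&& b
  | .lor, a, b => a ||| b
  | .lxor, a, b => a ^^^ b
  | .shl, a, b => a <<< b
  | .shr, a, b => a >>> b
  | .lt, a, b => if a < b then 1 else 0
  | .eq, a, b => if a = b then 1 else 0

/-- Programs. A program mentions finitely many registers; memory is reached by indirect
addressing, the address being the content of a register. -/
inductive Prog where
  /-- do nothing -/
  | skip : Prog
  /-- `r := c` -/
  | const (r c : ℕ) : Prog
  /-- `r := a o b` for registers `a`, `b` -/
  | op (o : BinOp) (r a b : ℕ) : Prog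
  /-- `r := M[a]`, the memory cell whose address is in register `a` -/
  | load (r a : ℕ) : Prog
  /-- `M[a] := r` -/
  | store (a r : ℕ) : Prog
  /-- first `p`, then `q` -/
  | seq (p q : Prog) : Prog
  /-- if register `r` is nonzero then `p` else `q` -/
  | branch (r : ℕ) (p q : Prog) : Prog
  /-- while register `r` is nonzero do `p` -/
  | loop (r : ℕ) (p : Prog) : Prog

/-- A machine state: contents of the registers and of the memory cells. -/
structure State where
  reg : ℕ → ℕ
  mem : ℕ → ℕ

/-- Overwrite a register. -/
def State.setReg (s : State) (r v : ℕ) : State := ⟨Function.update s.reg r v, s.mem⟩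

/-- Overwrite a memory cell. -/
def State.setMem (s : State) (a v : ℕ) : State := ⟨s.reg, Function.update s.mem a v⟩

/-- `Exec w p s t s'`: on a machine with words of `w` bits, program `p` started in state `s` halts
in state `s'` after exactly `t` steps. Each elementary instruction and each test costs one step.
A computation in which a register would receive a value that does not fit into `w` bits is
stuck: it does not count as halting. -/
inductive Exec (w : ℕ) : Prog → State → ℕ → State → Prop
  | skip (s : State) : Exec w .skip s 1 s
  | const (r c : ℕ) (s : State) (h : c < 2 ^ w) : Exec w (.const r c) s 1 (s.setReg r c)
  | op (o : BinOp) (r a b : ℕ) (s : State) (h : o.eval (s.reg a) (s.reg b) < 2 ^ w) :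
      Exec w (.op o r a b) s 1 (s.setReg r (o.eval (s.reg a) (s.reg b)))
  | load (r a : ℕ) (s : State) (h : s.mem (s.reg a) < 2 ^ w) :
      Exec w (.load r a) s 1 (s.setReg r (s.mem (s.reg a)))
  | store (a r : ℕ) (s : State) : Exec w (.store a r) s 1 (s.setMem (s.reg a) (s.reg r))
  | seq {p q : Prog} {s s' s'' : State} {t t' : ℕ} (hp : Exec w p s t s')
      (hq : Exec w q s' t' s'') : Exec w (.seq p q) s (t + t') s''
  | branch_true {r : ℕ} {p : Prog} (q : Prog) {s s' : State} {t : ℕ} (hr : s.reg r ≠ 0)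
      (hp : Exec w p s t s') : Exec w (.branch r p q) s (t + 1) s'
  | branch_false {r : ℕ} (p : Prog) {q : Prog} {s s' : State} {t : ℕ} (hr : s.reg r = 0)
      (hq : Exec w q s t s') : Exec w (.branch r p q) s (t + 1) s'
  | loop_true {r : ℕ} {p : Prog} {s s' s'' : State} {t t' : ℕ} (hr : s.reg r ≠ 0)
      (hp : Exec w p s t s') (hq : Exec w (.loop r p) s' t' s'') :
      Exec w (.loop r p) s (t + t' + 1) s''
  | loop_false {r : ℕ} (p : Prog) {s : State} (hr : s.reg r = 0) : Exec w (.loop r p) s 1 s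

/-- Initial state: the input occupies the memory cells `0, 1, 2, …`; everything else is zero. -/
def init (x : List ℕ) : State := ⟨fun _ => 0, fun i => x.getD i 0⟩

/-- `Solves P enc promise yes T`: on every instance `x` that satisfies the promise, `P` halts
within `T x` steps and leaves `1` in register `0` if `x` is a yes-instance and `0` otherwise,
on a machine whose word length is a constant times `log (input length + T x)`. -/
def Solves {α : Type} (P : Prog) (enc : α → List ℕ) (promise yes : α → Prop) (T : α → ℕ) : Prop :=
  ∃ c : ℕ, ∀ x, promise x → ∃ (t : ℕ) (s : State), t ≤ T x ∧
    Exec (c * (Nat.log 2 ((enc x).length + T x) + 1)) P (init (enc x)) t s ∧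
    (yes x → s.reg 0 = 1) ∧ (¬ yes x → s.reg 0 = 0)

end WordRAM

/-! ## Graph problems -/

/-- A finite undirected unweighted graph on `{0, …, n - 1}`, given by a list of its edges: no loops,
each edge listed once, in arbitrary order and orientation. -/
structure GraphInput where
  n : ℕ
  edges : List (Fin n × Fin n)
  loopless : ∀ e ∈ edges, e.1 ≠ e.2
  nodup : (edges.map fun e => s(e.1, e.2)).Nodup

/-- The graph that is described. -/
def GraphInput.graph (x : GraphInput) : SimpleGraph (Fin x.n) :=
  SimpleGraph.fromEdgeSet {e | e ∈ x.edges.map fun e => s(e.1, e.2)}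

/-- The number of edges. -/
def GraphInput.m (x : GraphInput) : ℕ := x.edges.length

/-- The input words `n, m, u₁, v₁, …, uₘ, vₘ`. -/
def GraphInput.encode (x : GraphInput) : List ℕ :=
  x.n :: x.m :: x.edges.flatMap fun e => [(e.1 : ℕ), (e.2 : ℕ)]

/-- Some algorithm distinguishes graphs of diameter 2 from graphs of diameter 3 in time `O(f(m))`,
`m` being the number of edges. -/
def DiameterTwoVsThreeInTime (f : ℕ → ℝ) : Prop :=
  ∃ (P : WordRAM.Prog) (T : ℕ → ℕ),
    (fun m => (T m : ℝ)) =O[atTop] f ∧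
    WordRAM.Solves P GraphInput.encode (fun x => x.graph.ediam = 2 ∨ x.graph.ediam = 3)
      (fun x => x.graph.ediam = 3) (fun x => T x.m)

/-- `S` dominates `G`: every vertex is in `S` or has a neighbour in `S`. -/
def IsDominatingSet {V : Type} (G : SimpleGraph V) (S : Finset V) : Prop :=
  ∀ v, v ∈ S ∨ ∃ u ∈ S, G.Adj v u

/-- Some algorithm solves `d`-dominating set on `n`-vertex graphs in time `O(f(n))`. -/
def DominatingSetInTime (d : ℕ) (f : ℕ → ℝ) : Prop :=
  ∃ (P : WordRAM.Prog) (T : ℕ → ℕ),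
    (fun n => (T n : ℝ)) =O[atTop] f ∧
    WordRAM.Solves P GraphInput.encode (fun _ => True)
      (fun x => ∃ S : Finset (Fin x.n), S.card = d ∧ IsDominatingSet x.graph S) (fun x => T x.n)

/-! ## Satisfiability and the strong exponential time hypothesis -/

/-- A CNF formula in the variables `0, …, n - 1`: a list of clauses, each a list of distinct
literals; the literal `(i, b)` says that variable `i` has the value `b`. -/
structure CNFInput where
  n : ℕ
  clauses : List (List (Fin n × Bool))
  nodup : ∀ c ∈ clauses, c.Nodup

/-- The number of clauses. -/
def CNFInput.m (x : CNFInput) : ℕ := x.clauses.length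

/-- The input words: `n`, `m`, then each clause as its length followed by its literals, `(i, b)`
being written as `2 * i + b`. -/
def CNFInput.encode (x : CNFInput) : List ℕ :=
  x.n :: x.m :: x.clauses.flatMap fun c =>
    c.length :: c.map fun l => 2 * (l.1 : ℕ) + (if l.2 then 1 else 0)

/-- Some assignment satisfies a literal of every clause. -/
def CNFInput.Satisfiable (x : CNFInput) : Prop :=
  ∃ a : Fin x.n → Bool, ∀ c ∈ x.clauses, ∃ l ∈ c, a l.1 = l.2

/-- Some algorithm decides satisfiability of the CNF formulas in the class `K` in time
`O*(2 ^ (δ n))`, that is, `2 ^ (δ n)` times a polynomial in the numbers `n` of variables and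
`m` of clauses. -/
def SatInTime (K : CNFInput → Prop) (δ : ℝ) : Prop :=
  ∃ (P : WordRAM.Prog) (T : ℕ → ℕ → ℕ),
    (∃ (C : ℝ) (c : ℕ), ∀ n m : ℕ,
      (T n m : ℝ) ≤ C * (2 : ℝ) ^ (δ * n) * ((n : ℝ) + m + 1) ^ c) ∧
    WordRAM.Solves P CNFInput.encode K CNFInput.Satisfiable (fun x => T x.n x.m)

/-- `s_r`, the infimum of the exponents `δ` such that `r`-SAT is solvable in time
`O*(2 ^ (δ n))`. -/
noncomputable def satExponent (r : ℕ) : ℝ :=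
  sInf {δ : ℝ | 0 ≤ δ ∧ SatInTime (fun x => ∀ c ∈ x.clauses, c.length ≤ r) δ}

/-- The strong exponential time hypothesis: `lim s_r = 1`. -/
def SETH : Prop := Tendsto satExponent atTop (𝓝 1)

/-! The bridge is the orthogonal vectors problem: given two lists of `N` Boolean vectors with `D`
coordinates, is there a pair, one vector from each list, without a common 1? Take the vectors, the
coordinates and two adjacent centers as vertices. Join a vector to the coordinates at which it is 1,
the center 0 to the first list, the center 1 to the second, and both centers to all coordinates. Two
vertices are within distance 2 unless they are vectors from different lists; such a pair is joined
by a path of length 3 through both centers, and its only possible common neighbours are common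
coordinates. So the diameter is 3 if an orthogonal pair exists and 2 otherwise
(`vectorGraph_ediam_eq_three_iff`), and the number of edges is at most `1 + 2D + 2N + 2ND`.

For dominating sets of size `2k`, both lists consist of the `n ^ k` tuples of `k` vertices, with a 1
at every vertex that the tuple leaves undominated; an orthogonal pair is a dominating set cut in
half (`exists_dominatingSet_iff`). The graph has O(n^(k+1)) edges, and `(k + 1)(2 - ε) ≤ 2k - ε`
amounts to `kε ≥ 2`. For satisfiability, the lists consist of the assignments to either half of the
variables, with a 1 at every clause left unsatisfied (`satisfiable_iff`). Now `N` is about 2^(n/2)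
and `D = m`, which gives 2^(n(1-ε/2)) up to polynomial factors, within the claimed bound since `ε²/4
≤ ε/2`. Clause width plays no role, so every `s_r` is at most `1 - ε²/4` and SETH fails.

The estimates are made for `ε ≤ 1`. For `ε > 1` the hypothesis is contradictory: a program has to
look at a linear number of input cells to tell a star from a star with one edge moved
(`linear_le_of_solves_diameter`).

On the machine, explicit programs write the table of vectors and then the graph into fresh memory.
The given program runs there as a subroutine with shifted registers and addresses (`Exec.relocate`),
and the word length grows only by a constant factor (`word_bound`). -/

namespace WordRAM

/-! ### Reasoning about programs -/

/-- The state whose registers hold the entries of `l` (and zero beyond). -/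
def st (l : List ℕ) (m : ℕ → ℕ) : State := ⟨fun i => l.getD i 0, m⟩

theorem st_setReg {l : List ℕ} {r : ℕ} (h : r < l.length) (m : ℕ → ℕ) (v : ℕ) :
    (st l m).setReg r v = st (l.set r v) m := by
  simp only [st, State.setReg, State.mk.injEq, and_true]
  funext i
  by_cases hi : i = r
  · subst hi; simp [h]
  · simp [Function.update_of_ne hi, List.getElem?_set_ne (Ne.symm hi)]

/-- `p`, started in `st l m`, halts within `T` steps in a state that satisfies `Q`. -/
def Ex (w : ℕ) (p : Prog) (l : List ℕ) (m : ℕ → ℕ) (T : ℕ)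
    (Q : List ℕ → (ℕ → ℕ) → Prop) : Prop :=
  ∃ t l' m', t ≤ T ∧ Exec w p (st l m) t (st l' m') ∧ Q l' m'

theorem Ex.mono {w p l m T T' Q} {Q' : List ℕ → (ℕ → ℕ) → Prop} (h : Ex w p l m T Q)
    (hT : T ≤ T') (hQ : ∀ l m, Q l m → Q' l m) : Ex w p l m T' Q' := by
  obtain ⟨t, l', m', h1, h2, h3⟩ := h
  exact ⟨t, l', m', h1.trans hT, h2, hQ _ _ h3⟩

theorem Ex.seq {w p q l m T T' R Q} (h : Ex w p l m T R)
    (h' : ∀ l m, R l m → Ex w q l m T' Q) : Ex w (.seq p q) l m (T + T') Q := by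
  obtain ⟨t, l1, m1, ht, he, hr⟩ := h
  obtain ⟨t', l2, m2, ht', he', hq⟩ := h' _ _ hr
  exact ⟨t + t', l2, m2, by omega, .seq he he', hq⟩

/-- Weakest precondition of a program without loops. -/
def wp (w : ℕ) : Prog → List ℕ → (ℕ → ℕ) → (List ℕ → (ℕ → ℕ) → Prop) → Prop
  | .skip, l, m, Q => Q l m
  | .const r c, l, m, Q => c < 2 ^ w ∧ r < l.length ∧ Q (l.set r c) m
  | .op o r a b, l, m, Q => o.eval (l.getD a 0) (l.getD b 0) < 2 ^ w ∧ r < l.length ∧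
      Q (l.set r (o.eval (l.getD a 0) (l.getD b 0))) m
  | .load r a, l, m, Q => m (l.getD a 0) < 2 ^ w ∧ r < l.length ∧
      Q (l.set r (m (l.getD a 0))) m
  | .store a r, l, m, Q => Q l (Function.update m (l.getD a 0) (l.getD r 0))
  | .seq p q, l, m, Q => wp w p l m fun l m => wp w q l m Q
  | .branch r p q, l, m, Q => (l.getD r 0 ≠ 0 → wp w p l m Q) ∧ (l.getD r 0 = 0 → wp w q l m Q)
  | .loop _ _, _, _, _ => False

/-- Running time of a program without loops. -/
def cost : Prog → ℕ
  | .seq p q => cost p + cost q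
  | .branch _ p q => max (cost p) (cost q) + 1
  | _ => 1

/-- Evaluating `wp` symbolically replaces the execution of straight-line code by arithmetic side
conditions. A branch is charged its dearer arm, so the time bound does not depend on the data. -/
theorem Ex.of_wp {w : ℕ} {p : Prog} : ∀ {l m Q}, wp w p l m Q → Ex w p l m (cost p) Q := by
  induction p with
  | skip => intro l m Q h; exact ⟨1, l, m, le_rfl, .skip _, h⟩
  | const r c =>
    intro l m Q ⟨h1, h2, h3⟩
    exact ⟨1, _, _, le_rfl, st_setReg h2 m c ▸ .const r c _ h1, h3⟩
  | op o r a b =>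
    intro l m Q ⟨h1, h2, h3⟩
    exact ⟨1, _, _, le_rfl, st_setReg h2 m _ ▸ .op o r a b (st l m) h1, h3⟩
  | load r a =>
    intro l m Q ⟨h1, h2, h3⟩
    exact ⟨1, _, _, le_rfl, st_setReg h2 m _ ▸ .load r a (st l m) h1, h3⟩
  | store a r => intro l m Q h; exact ⟨1, l, _, le_rfl, .store a r (st l m), h⟩
  | seq p q hp hq => intro l m Q h; exact Ex.seq (hp h) fun _ _ h => hq h
  | branch r p q hp hq =>
    intro l m Q ⟨h1, h2⟩
    by_cases hr : l.getD r 0 = 0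
    · obtain ⟨t, l', m', ht, he, h⟩ := hq (h2 hr)
      exact ⟨t + 1, l', m', by simp only [cost]; omega, .branch_false p hr he, h⟩
    · obtain ⟨t, l', m', ht, he, h⟩ := hp (h1 hr)
      exact ⟨t + 1, l', m', by simp only [cost]; omega, .branch_true q hr he, h⟩
  | loop r p _ => intro l m Q h; exact h.elim

/-- Rule for a loop whose test register counts down from `n` to `0`. -/
theorem Ex.for {w r p l m} (n K : ℕ) (I : ℕ → List ℕ → (ℕ → ℕ) → Prop)
    (hreg : ∀ i l m, I i l m → l.getD r 0 = n - i)
    (hstep : ∀ i l m, i < n → I i l m → Ex w p l m K (I (i + 1))) (h0 : I 0 l m) :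
    Ex w (.loop r p) l m (n * (K + 1) + 1) (I n) := by
  suffices H : ∀ j i l m, i + j = n → I i l m → Ex w (.loop r p) l m (j * (K + 1) + 1) (I n) from
    H n 0 l m (by omega) h0
  intro j
  induction j with
  | zero =>
    intro i l m hij hI
    have h := hreg i l m hI
    obtain rfl : i = n := by omega
    exact ⟨1, l, m, by omega, .loop_false p (by simpa [st] using h), hI⟩
  | succ j ih =>
    intro i l m hij hI
    obtain ⟨t, l1, m1, ht, he, h1⟩ := hstep i l m (by omega) hI
    obtain ⟨t', l2, m2, ht', he', h2⟩ := ih (i + 1) l1 m1 (by omega) h1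
    refine ⟨t + t' + 1, l2, m2, ?_, .loop_true ?_ he he', h2⟩
    · rw [add_mul]; omega
    · have := hreg i l m hI
      simp only [st]; omega

/-- Sequential composition of a list of programs. -/
def block : List Prog → Prog
  | [] => .skip
  | p :: ps => .seq p (block ps)

/-! ### Memory with a region that grows -/

/-- Memory that is `low` below `base` and holds the list `out` from `base` on. -/
def lay (low : ℕ → ℕ) (base : ℕ) (out : List ℕ) : ℕ → ℕ :=
  fun a => if a < base then low a else out.getD (a - base) 0

theorem lay_of_lt {low base out a} (h : a < base) : lay low base out a = low a := if_pos h

theorem lay_add (low base out) (i : ℕ) : lay low base out (base + i) = out.getD i 0 := by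
  simp [lay]

theorem lay_nil {x : List ℕ} {base : ℕ} (h : x.length ≤ base) :
    (fun i => x.getD i 0) = lay (fun i => x.getD i 0) base [] := by
  funext a
  simp only [lay]
  split
  · rfl
  · rw [List.getD_eq_default _ _ (by omega)]; rfl

/-- Everything behind the written list is zero, so a new empty region may start anywhere behind it.
In this way input, matrix, table and graph are stacked in one memory. -/
theorem lay_nil_lay {low base out base'} (h : base + out.length ≤ base') :
    lay low base out = lay (lay low base out) base' [] := by
  funext a
  simp only [lay]
  split <;> split <;> try rfl
  · omega
  · rw [List.getD_eq_default _ _ (by omega)]; rfl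

theorem update_lay {low base} {out : List ℕ} {a : ℕ} (h : a = base + out.length) (v : ℕ) :
    Function.update (lay low base out) a v = lay low base (out ++ [v]) := by
  subst h
  funext a
  by_cases ha : a = base + out.length
  · subst ha; simp [lay]
  · rw [Function.update_of_ne ha]
    simp only [lay]
    split
    · rfl
    · rcases lt_or_ge (a - base) out.length with h1 | h1
      · rw [List.getD_append _ _ _ _ h1]
      · rw [List.getD_eq_default _ _ h1, List.getD_eq_default]
        simp; omega

theorem update_lay_set {low base} {out : List ℕ} {i : ℕ} (h : i < out.length) (v : ℕ) :
    Function.update (lay low base out) (base + i) v = lay low base (out.set i v) := by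
  funext a
  by_cases ha : a = base + i
  · subst ha; simp [lay, h]
  · rw [Function.update_of_ne ha]
    simp only [lay]
    split
    · rfl
    · simp only [List.getD_eq_getElem?_getD]
      rw [List.getElem?_set_ne (by omega)]

end WordRAM

namespace WordRAM

/-! ### Relocation of programs -/

/-- The program `p` with all its registers shifted by `K` and all its addresses shifted by the
content of register `b`; register `x` is used for addresses. -/
def Prog.relocate (K b x : ℕ) : Prog → Prog
  | .skip => .skip
  | .const r c => .const (K + r) c
  | .op o r a c => .op o (K + r) (K + a) (K + c)
  | .load r a => .seq (.op .add x b (K + a)) (.load (K + r) x)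
  | .store a r => .seq (.op .add x b (K + a)) (.store x (K + r))
  | .seq p q => .seq (p.relocate K b x) (q.relocate K b x)
  | .branch r p q => .branch (K + r) (p.relocate K b x) (q.relocate K b x)
  | .loop r p => .loop (K + r) (p.relocate K b x)

/-- The state `s'` contains the state `s`, shifted by `K` registers and `B` memory cells. -/
structure Embeds (K b B : ℕ) (s s' : State) : Prop where
  reg : ∀ r, s'.reg (K + r) = s.reg r
  mem : ∀ a, s'.mem (B + a) = s.mem a
  base : s'.reg b = B

theorem Embeds.setReg {K b B s s'} (h : Embeds K b B s s') (hb : b < K) (r v : ℕ) :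
    Embeds K b B (s.setReg r v) (s'.setReg (K + r) v) where
  reg i := by
    simp only [State.setReg, Function.update_apply, Nat.add_left_cancel_iff, h.reg]
  mem := h.mem
  base := by
    simp only [State.setReg]
    rw [Function.update_of_ne (by omega), h.base]

theorem Embeds.setMem {K b B s s'} (h : Embeds K b B s s') (a v : ℕ) :
    Embeds K b B (s.setMem a v) (s'.setMem (B + a) v) where
  reg := h.reg
  mem i := by
    simp only [State.setMem, Function.update_apply, Nat.add_left_cancel_iff, h.mem]
  base := h.base

theorem Embeds.setReg_right {K b B s s'} (h : Embeds K b B s s') {x : ℕ} (hx : x < K) (hxb : x ≠ b)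
    (v : ℕ) : Embeds K b B s (s'.setReg x v) where
  reg i := by
    simp only [State.setReg]
    rw [Function.update_of_ne (by omega), h.reg]
  mem := h.mem
  base := by
    simp only [State.setReg]
    rw [Function.update_of_ne hxb.symm, h.base]

theorem reg_setReg_lt {s : State} {M r v : ℕ} (hs : ∀ i, s.reg i < M) (hv : v < M) (i : ℕ) :
    (s.setReg r v).reg i < M := by
  simp only [State.setReg, Function.update_apply]
  split
  · exact hv
  · exact hs i

/-- Simulation instruction by instruction. The registers of the simulated run stay below `2 ^ w`, so
a shifted address is below `B + 2 ^ w` and fits into the longer words. A load or store becomes an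
addition followed by the access, hence the factor 2. -/
theorem Exec.relocate {w w' K b x B : ℕ} (hb : b < K) (hx : x < K) (hxb : x ≠ b)
    (hw : B + 2 ^ w ≤ 2 ^ w') {p s t s'} (h : Exec w p s t s') :
    ∀ σ, Embeds K b B s σ → (∀ i, s.reg i < 2 ^ w) →
      ∃ t' σ', t' ≤ 2 * t ∧ Exec w' (p.relocate K b x) σ t' σ' ∧ Embeds K b B s' σ' ∧
        ∀ i, s'.reg i < 2 ^ w := by
  have hx' (σ : State) (v : ℕ) : (σ.setReg x v).reg x = v := by simp [State.setReg]
  induction h with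
  | skip s => exact fun σ hσ hs => ⟨1, σ, by omega, .skip _, hσ, hs⟩
  | const r c s hc =>
    exact fun σ hσ hs => ⟨1, _, by omega, .const _ _ _ (by omega), hσ.setReg hb r c,
      reg_setReg_lt hs hc⟩
  | op o r a c s hc =>
    intro σ hσ hs
    have h1 := Exec.op (w := w') o (K + r) (K + a) (K + c) σ (by rw [hσ.reg, hσ.reg]; omega)
    rw [hσ.reg, hσ.reg] at h1
    exact ⟨1, _, by omega, h1, hσ.setReg hb r _, reg_setReg_lt hs hc⟩
  | load r a s hc =>
    intro σ hσ hs
    have h1 := Exec.op (w := w') .add x b (K + a) σ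
      (by rw [hσ.reg, hσ.base]; simp only [BinOp.eval]; have := hs a; omega)
    rw [hσ.reg, hσ.base] at h1
    have h2 := hσ.setReg_right hx hxb (B + s.reg a)
    have h3 := Exec.load (w := w') (K + r) x (σ.setReg x (B + s.reg a))
      (by rw [hx', h2.mem]; omega)
    rw [hx', h2.mem] at h3
    exact ⟨2, _, by omega, .seq h1 h3, h2.setReg hb _ _, reg_setReg_lt hs hc⟩
  | store a r s =>
    intro σ hσ hs
    have h1 := Exec.op (w := w') .add x b (K + a) σ
      (by rw [hσ.reg, hσ.base]; simp only [BinOp.eval]; have := hs a; omega)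
    rw [hσ.reg, hσ.base] at h1
    have h2 := hσ.setReg_right hx hxb (B + s.reg a)
    have h3 := Exec.store (w := w') x (K + r) (σ.setReg x (B + s.reg a))
    rw [hx', h2.reg] at h3
    exact ⟨2, _, by omega, .seq h1 h3, h2.setMem _ _, hs⟩
  | seq _ _ ihp ihq =>
    intro σ hσ hs
    obtain ⟨t1, σ1, ht1, he1, hσ1, hs1⟩ := ihp σ hσ hs
    obtain ⟨t2, σ2, ht2, he2, hσ2, hs2⟩ := ihq σ1 hσ1 hs1
    exact ⟨t1 + t2, σ2, by omega, .seq he1 he2, hσ2, hs2⟩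
  | branch_true q hr _ ih =>
    intro σ hσ hs
    obtain ⟨t1, σ1, ht1, he1, hσ1, hs1⟩ := ih σ hσ hs
    exact ⟨t1 + 1, σ1, by omega, .branch_true _ (by rwa [hσ.reg]) he1, hσ1, hs1⟩
  | branch_false q hr _ ih =>
    intro σ hσ hs
    obtain ⟨t1, σ1, ht1, he1, hσ1, hs1⟩ := ih σ hσ hs
    exact ⟨t1 + 1, σ1, by omega, .branch_false _ (by rwa [hσ.reg]) he1, hσ1, hs1⟩
  | loop_true hr _ _ ihp ihq =>
    intro σ hσ hs
    obtain ⟨t1, σ1, ht1, he1, hσ1, hs1⟩ := ihp σ hσ hs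
    obtain ⟨t2, σ2, ht2, he2, hσ2, hs2⟩ := ihq σ1 hσ1 hs1
    exact ⟨t1 + t2 + 1, σ2, by omega, .loop_true (by rwa [hσ.reg]) he1 he2, hσ2, hs2⟩
  | loop_false p hr =>
    exact fun σ hσ hs => ⟨1, σ, by omega, .loop_false _ (by rwa [hσ.reg]), hσ, hs⟩

/-! ### Executions are deterministic and read few cells -/

theorem Exec.deterministic {w p s t s'} (h : Exec w p s t s') :
    ∀ {t₁ s₁}, Exec w p s t₁ s₁ → s' = s₁ := by
  induction h with
  | skip | const | op | load | store => intro _ _ h; cases h; rfl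
  | seq _ _ ihp ihq => intro _ _ h; cases h with | seq h1 h2 => cases ihp h1; exact ihq h2
  | branch_true _ hr _ ih =>
    intro _ _ h
    cases h with
    | branch_true _ _ h => exact ih h
    | branch_false _ h => exact absurd h hr
  | branch_false _ hr _ ih =>
    intro _ _ h
    cases h with
    | branch_true _ h => exact absurd hr h
    | branch_false _ _ h => exact ih h
  | loop_true hr _ _ ihp ihq =>
    intro _ _ h
    cases h with
    | loop_true _ h1 h2 => cases ihp h1; exact ihq h2
    | loop_false _ h => exact absurd h hr
  | loop_false _ hr =>
    intro _ _ h
    cases h with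
    | loop_true h => exact absurd hr h
    | loop_false => rfl

/-- `R` collects the addresses of the loads; no other cell can influence registers or control flow.
Agreement of the two memories at a cell survives the run, because both runs store the same values at
the same addresses; this is what makes the union of the two sets work for sequential composition. -/
theorem Exec.exists_reads {w p s t s'} (h : Exec w p s t s') :
    ∃ R : Finset ℕ, R.card ≤ t ∧ ∀ m, (∀ a ∈ R, m a = s.mem a) →
      ∃ m', Exec w p ⟨s.reg, m⟩ t ⟨s'.reg, m'⟩ ∧ ∀ a, m a = s.mem a → m' a = s'.mem a := by
  induction h with
  | skip s => exact ⟨∅, by simp, fun m _ => ⟨m, .skip _, fun _ h => h⟩⟩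
  | const r c s hc => exact ⟨∅, by simp, fun m _ => ⟨m, .const r c ⟨s.reg, m⟩ hc, fun _ h => h⟩⟩
  | op o r a b s hc =>
    exact ⟨∅, by simp, fun m _ => ⟨m, .op o r a b ⟨s.reg, m⟩ hc, fun _ h => h⟩⟩
  | load r a s hc =>
    refine ⟨{s.reg a}, by simp, fun m hm => ⟨m, ?_, fun _ h => h⟩⟩
    have h : m (s.reg a) = s.mem (s.reg a) := hm _ (by simp)
    have h1 := Exec.load (w := w) r a ⟨s.reg, m⟩ (by simpa [h] using hc)
    simpa only [State.setReg, h] using h1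
  | store a r s =>
    refine ⟨∅, by simp, fun m _ => ⟨_, .store a r ⟨s.reg, m⟩, fun i hi => ?_⟩⟩
    simp only [State.setMem, Function.update_apply, hi]
  | seq _ _ ihp ihq =>
    obtain ⟨R1, hR1, h1⟩ := ihp
    obtain ⟨R2, hR2, h2⟩ := ihq
    refine ⟨R1 ∪ R2, (Finset.card_union_le _ _).trans (by omega), fun m hm => ?_⟩
    obtain ⟨m1, he1, hm1⟩ := h1 m fun a ha => hm a (by simp [ha])
    obtain ⟨m2, he2, hm2⟩ := h2 m1 fun a ha => hm1 a (hm a (by simp [ha]))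
    exact ⟨m2, .seq he1 he2, fun a ha => hm2 a (hm1 a ha)⟩
  | branch_true q hr _ ih =>
    obtain ⟨R, hR, h⟩ := ih
    refine ⟨R, by omega, fun m hm => ?_⟩
    obtain ⟨m', he, hm'⟩ := h m hm
    exact ⟨m', .branch_true q hr he, hm'⟩
  | branch_false q hr _ ih =>
    obtain ⟨R, hR, h⟩ := ih
    refine ⟨R, by omega, fun m hm => ?_⟩
    obtain ⟨m', he, hm'⟩ := h m hm
    exact ⟨m', .branch_false q hr he, hm'⟩
  | loop_true hr _ _ ihp ihq =>
    obtain ⟨R1, hR1, h1⟩ := ihp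
    obtain ⟨R2, hR2, h2⟩ := ihq
    refine ⟨R1 ∪ R2, (Finset.card_union_le _ _).trans (by omega), fun m hm => ?_⟩
    obtain ⟨m1, he1, hm1⟩ := h1 m fun a ha => hm a (by simp [ha])
    obtain ⟨m2, he2, hm2⟩ := h2 m1 fun a ha => hm1 a (hm a (by simp [ha]))
    exact ⟨m2, .loop_true hr he1 he2, fun a ha => hm2 a (hm1 a ha)⟩
  | loop_false p hr => exact ⟨∅, by simp, fun m _ => ⟨m, .loop_false p hr, fun _ h => h⟩⟩

end WordRAM

/-! ### Graphs of small diameter -/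

namespace SimpleGraph

variable {V : Type*} {G : SimpleGraph V}

theorem edist_le_two_of_adj {u v z : V} (h1 : G.Adj u z) (h2 : G.Adj z v) : G.edist u v ≤ 2 :=
  (Walk.cons h1 (Walk.cons h2 Walk.nil)).edist_le

theorem edist_le_three_of_adj {u v z y : V} (h1 : G.Adj u z) (h2 : G.Adj z y) (h3 : G.Adj y v) :
    G.edist u v ≤ 3 :=
  (Walk.cons h1 (Walk.cons h2 (Walk.cons h3 Walk.nil))).edist_le

theorem two_le_ediam {u v : V} (huv : u ≠ v) (h : ¬ G.Adj u v) : 2 ≤ G.ediam := by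
  refine le_trans ?_ (edist_le_ediam (u := u) (v := v))
  by_contra! hlt
  have h1 : G.edist u v ≤ 1 := Order.le_of_lt_add_one hlt
  rcases edist_le_one_iff_adj_or_eq.1 h1 with h1 | h1
  · exact h h1
  · exact huv h1

theorem three_le_ediam {u v : V} (huv : u ≠ v) (h : ¬ G.Adj u v)
    (hz : ∀ z, G.Adj u z → ¬ G.Adj z v) : 3 ≤ G.ediam := by
  refine le_trans ?_ (edist_le_ediam (u := u) (v := v))
  by_contra! hlt
  have hne : G.edist u v ≠ ⊤ := hlt.ne_top
  obtain ⟨p, hp⟩ := exists_walk_of_edist_ne_top hne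
  rw [← hp] at hlt
  have hl : p.length < 3 := by exact_mod_cast hlt
  match p, hl with
  | .nil, _ => exact huv rfl
  | .cons h1 .nil, _ => exact h h1
  | .cons h1 (.cons h2 .nil), _ => exact hz _ h1 h2
  | .cons _ (.cons _ (.cons _ _)), hl => simp at hl; omega

end SimpleGraph

/-! ### Graph inputs from lists of pairs of numbers -/

/-- The graph on `{0, …, n - 1}` with the edges in the list `L`, whose pairs are increasing. -/
def GraphInput.ofPairs (n : ℕ) (L : List (ℕ × ℕ)) (hL : ∀ e ∈ L, e.1 < e.2 ∧ e.2 < n)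
    (hd : L.Nodup) : GraphInput where
  n := n
  edges := L.pmap (fun e h => (⟨e.1, h.1.trans h.2⟩, ⟨e.2, h.2⟩)) hL
  loopless e he := by
    obtain ⟨a, ha, rfl⟩ := List.mem_pmap.1 he
    have := (hL a ha).1
    simp only [ne_eq, Fin.mk.injEq]; omega
  nodup := by
    rw [List.map_pmap]
    refine List.Nodup.pmap ?_ hd
    rintro ⟨a, b⟩ ⟨h1, h2⟩ ⟨c, d⟩ ⟨h3, h4⟩ h
    simp only [Sym2.eq_iff, Fin.mk.injEq, Prod.mk.injEq] at h h1 h3 ⊢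
    omega

namespace GraphInput

variable {n : ℕ} {L : List (ℕ × ℕ)} {hL : ∀ e ∈ L, e.1 < e.2 ∧ e.2 < n} {hd : L.Nodup}

theorem ofPairs_m : (ofPairs n L hL hd).m = L.length := by simp [ofPairs, m]

theorem ofPairs_encode :
    (ofPairs n L hL hd).encode = n :: L.length :: L.flatMap fun e => [e.1, e.2] := by
  have h : ∀ (L : List (ℕ × ℕ)) (hL : ∀ e ∈ L, e.1 < e.2 ∧ e.2 < n),
      (L.pmap (fun e h => ((⟨e.1, h.1.trans h.2⟩, ⟨e.2, h.2⟩) : Fin n × Fin n)) hL).flatMap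
        (fun e => [(e.1 : ℕ), (e.2 : ℕ)]) = L.flatMap fun e => [e.1, e.2] := by
    intro L hL
    induction L with
    | nil => rfl
    | cons e L ih =>
      simp only [List.pmap_cons, List.flatMap_cons]
      rw [ih]
  rw [← h L hL, ← ofPairs_m]
  rfl

theorem ofPairs_adj {u v : Fin (ofPairs n L hL hd).n} :
    (ofPairs n L hL hd).graph.Adj u v ↔ (u.val, v.val) ∈ L ∨ (v.val, u.val) ∈ L := by
  have key : ∀ u v : Fin n, s(u, v) ∈ L.pmap (fun e h =>
      (s(⟨e.1, h.1.trans h.2⟩, ⟨e.2, h.2⟩) : Sym2 (Fin n))) hL ∧ u ≠ v ↔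
      (u.val, v.val) ∈ L ∨ (v.val, u.val) ∈ L := by
    intro u v
    rw [List.mem_pmap]
    constructor
    · rintro ⟨⟨⟨a, b⟩, hab, h⟩, -⟩
      rcases Sym2.eq_iff.1 h with ⟨rfl, rfl⟩ | ⟨rfl, rfl⟩
      · exact .inl hab
      · exact .inr hab
    · rintro (h | h)
      · refine ⟨⟨_, h, rfl⟩, ?_⟩
        rintro rfl
        exact (hL _ h).1.ne rfl
      · refine ⟨⟨_, h, Sym2.eq_swap⟩, ?_⟩
        rintro rfl
        exact (hL _ h).1.ne rfl
  rw [graph, SimpleGraph.fromEdgeSet_adj]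
  simp only [ofPairs, List.map_pmap]
  exact key u v

theorem ofPairs_ediam_le_two
    (h : ∀ u v, u < v → v < n → (u, v) ∈ L ∨
      ∃ z < n, ((u, z) ∈ L ∨ (z, u) ∈ L) ∧ ((z, v) ∈ L ∨ (v, z) ∈ L)) :
    (ofPairs n L hL hd).graph.ediam ≤ 2 := by
  have key : ∀ u v : Fin (ofPairs n L hL hd).n, u.val < v.val →
      (ofPairs n L hL hd).graph.edist u v ≤ 2 := by
    intro u v huv
    rcases h u v huv v.2 with h | ⟨z, hz, h1, h2⟩
    · rw [SimpleGraph.edist_eq_one_iff_adj.2 (ofPairs_adj.2 (.inl h))]; norm_num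
    · exact SimpleGraph.edist_le_two_of_adj (z := ⟨z, hz⟩) (ofPairs_adj.2 h1) (ofPairs_adj.2 h2)
  refine SimpleGraph.ediam_le_of_edist_le fun u v => ?_
  rcases lt_trichotomy u.val v.val with huv | huv | huv
  · exact key u v huv
  · rw [Fin.ext huv]; simp
  · rw [SimpleGraph.edist_comm]; exact key v u huv

theorem two_le_ofPairs_ediam {u v : ℕ} (huv : u < v) (hv : v < n) (h : (u, v) ∉ L) :
    2 ≤ (ofPairs n L hL hd).graph.ediam := by
  refine SimpleGraph.two_le_ediam (u := ⟨u, huv.trans hv⟩) (v := ⟨v, hv⟩)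
    (fun h => huv.ne (Fin.mk.inj h)) ?_
  rw [ofPairs_adj]
  rintro (h1 | h1)
  · exact h h1
  · have := hL _ h1; dsimp at this; omega

theorem three_le_ofPairs_ediam {u v : ℕ} (huv : u < v) (hv : v < n) (h : (u, v) ∉ L)
    (hz : ∀ z, ((u, z) ∈ L ∨ (z, u) ∈ L) → (z, v) ∉ L ∧ (v, z) ∉ L) :
    3 ≤ (ofPairs n L hL hd).graph.ediam := by
  refine SimpleGraph.three_le_ediam (u := ⟨u, huv.trans hv⟩) (v := ⟨v, hv⟩)
    (fun h => huv.ne (Fin.mk.inj h)) ?_ ?_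
  · rw [ofPairs_adj]
    rintro (h1 | h1)
    · exact h h1
    · have := hL _ h1; dsimp at this; omega
  · intro z h1 h2
    rw [ofPairs_adj] at h1 h2
    have := hz z h1
    tauto

theorem ofPairs_ediam_le_three
    (h : ∀ u v, u < v → v < n → (u, v) ∈ L ∨
      (∃ z < n, ((u, z) ∈ L ∨ (z, u) ∈ L) ∧ ((z, v) ∈ L ∨ (v, z) ∈ L)) ∨
      ∃ z < n, ∃ y < n, ((u, z) ∈ L ∨ (z, u) ∈ L) ∧ ((z, y) ∈ L ∨ (y, z) ∈ L) ∧
        ((y, v) ∈ L ∨ (v, y) ∈ L)) :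
    (ofPairs n L hL hd).graph.ediam ≤ 3 := by
  have key : ∀ u v : Fin (ofPairs n L hL hd).n, u.val < v.val →
      (ofPairs n L hL hd).graph.edist u v ≤ 3 := by
    intro u v huv
    rcases h u v huv v.2 with h | ⟨z, hz, h1, h2⟩ | ⟨z, hz, y, hy, h1, h2, h3⟩
    · rw [SimpleGraph.edist_eq_one_iff_adj.2 (ofPairs_adj.2 (.inl h))]; norm_num
    · exact (SimpleGraph.edist_le_two_of_adj (z := ⟨z, hz⟩) (ofPairs_adj.2 h1)
        (ofPairs_adj.2 h2)).trans (by norm_num)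
    · exact SimpleGraph.edist_le_three_of_adj (z := ⟨z, hz⟩) (y := ⟨y, hy⟩) (ofPairs_adj.2 h1)
        (ofPairs_adj.2 h2) (ofPairs_adj.2 h3)
  refine SimpleGraph.ediam_le_of_edist_le fun u v => ?_
  rcases lt_trichotomy u.val v.val with huv | huv | huv
  · exact key u v huv
  · rw [Fin.ext huv]; simp
  · rw [SimpleGraph.edist_comm]; exact key v u huv

theorem encode_length (x : GraphInput) : x.encode.length = 2 + 2 * x.m := by
  have : ∀ E : List (Fin x.n × Fin x.n),
      (E.flatMap fun e => [(e.1 : ℕ), (e.2 : ℕ)]).length = 2 * E.length := by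
    intro E
    induction E with
    | nil => rfl
    | cons e E ih => simp [ih]; omega
  simp only [encode, List.length_cons, this, m]
  omega

end GraphInput

/-! ### The graph of an orthogonal vectors instance -/

/-- The edges between the coordinate `c` and the vectors with index `i`. -/
def bitEdges (N D : ℕ) (U V : ℕ → ℕ → Bool) (i c : ℕ) : List (ℕ × ℕ) :=
  (if U i c then [(2 + c, 2 + D + i)] else []) ++ if V i c then [(2 + c, 2 + D + N + i)] else []

/-- The edges at the vectors with index `i`, for the first `k` coordinates. -/
def rowEdges (N D : ℕ) (U V : ℕ → ℕ → Bool) (k i : ℕ) : List (ℕ × ℕ) :=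
  (0, 2 + D + i) :: (1, 2 + D + N + i) :: (List.range k).flatMap (bitEdges N D U V i)

/-- The edges between the coordinate `c` and the two centers. -/
def coordEdges (c : ℕ) : List (ℕ × ℕ) := [(0, 2 + c), (1, 2 + c)]

/-- The vertices are `0`, `1`, the coordinates `c < D` at `2 + c`, and the vectors of the two sides
at `2 + D + i` and `2 + D + N + i`. A vector is adjacent to the coordinates at which it is nonzero;
`0` is adjacent to `1`, to all coordinates and to the first side, and `1` is adjacent to all
coordinates and to the second side. -/
def vectorEdges (N D : ℕ) (U V : ℕ → ℕ → Bool) : List (ℕ × ℕ) :=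
  (0, 1) :: ((List.range D).flatMap coordEdges ++ (List.range N).flatMap (rowEdges N D U V D))

/-- The blocks are disjoint because `key` recovers from an element the index of its block. -/
theorem List.nodup_flatMap_range {β : Type*} {f : ℕ → List β} {N : ℕ} (key : β → ℕ)
    (h1 : ∀ i < N, (f i).Nodup) (h2 : ∀ i < N, ∀ e ∈ f i, key e = i) :
    ((List.range N).flatMap f).Nodup := by
  rw [List.nodup_flatMap]
  refine ⟨fun i hi => h1 i (List.mem_range.1 hi), ?_⟩
  refine List.Nodup.pairwise_of_forall_ne List.nodup_range fun i hi j hj hij e he he' => hij ?_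
  rw [← h2 i (List.mem_range.1 hi) e he, h2 j (List.mem_range.1 hj) e he']

section

variable {N D : ℕ} {U V : ℕ → ℕ → Bool}

theorem mem_bitEdges {i c : ℕ} {e : ℕ × ℕ} : e ∈ bitEdges N D U V i c ↔
    (U i c ∧ e = (2 + c, 2 + D + i)) ∨ (V i c ∧ e = (2 + c, 2 + D + N + i)) := by
  simp only [bitEdges, List.mem_append, List.mem_ite_nil_right, List.mem_singleton]

theorem mem_vectorEdges {e : ℕ × ℕ} : e ∈ vectorEdges N D U V ↔ e = (0, 1) ∨
    (∃ c < D, e = (0, 2 + c) ∨ e = (1, 2 + c)) ∨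
    ∃ i < N, e = (0, 2 + D + i) ∨ e = (1, 2 + D + N + i) ∨
      ∃ c < D, (U i c ∧ e = (2 + c, 2 + D + i)) ∨ (V i c ∧ e = (2 + c, 2 + D + N + i)) := by
  simp only [vectorEdges, coordEdges, rowEdges, List.mem_cons, List.mem_append, List.mem_flatMap,
    List.mem_range, List.not_mem_nil, or_false, mem_bitEdges]

theorem vectorEdges_lt : ∀ e ∈ vectorEdges N D U V, e.1 < e.2 ∧ e.2 < 2 + D + 2 * N := by
  intro e he
  rcases mem_vectorEdges.1 he with rfl | ⟨c, hc, rfl | rfl⟩ |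
    ⟨i, hi, rfl | rfl | ⟨c, hc, ⟨-, rfl⟩ | ⟨-, rfl⟩⟩⟩ <;> dsimp <;> omega

theorem rowEdges_nodup {i : ℕ} (hi : i < N) : (rowEdges N D U V D i).Nodup := by
  refine List.nodup_cons.2 ⟨?_, List.nodup_cons.2 ⟨?_, ?_⟩⟩
  · simp only [List.mem_cons, List.mem_flatMap, mem_bitEdges, Prod.mk.injEq, not_or, not_exists,
      not_and]
    refine ⟨by omega, fun c _ => ?_⟩
    omega
  · simp only [List.mem_flatMap, mem_bitEdges, Prod.mk.injEq, not_or, not_exists,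
      not_and]
    intro c _
    omega
  · refine List.nodup_flatMap_range (fun e => e.1 - 2) (fun c _ => ?_) fun c _ e he => ?_
    · unfold bitEdges
      split <;> split <;> simp
      omega
    · rcases mem_bitEdges.1 he with ⟨-, rfl⟩ | ⟨-, rfl⟩ <;> simp

/-- The larger endpoint tells the blocks apart: it is 1 for the edge between the centers, a
coordinate for `coordEdges`, and one of the two vectors of the row for `rowEdges`. -/
theorem vectorEdges_nodup : (vectorEdges N D U V).Nodup := by
  have hrow : ∀ i < N, ∀ e ∈ rowEdges N D U V D i, e.2 = 2 + D + i ∨ e.2 = 2 + D + N + i := by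
    intro i hi e he
    simp only [rowEdges, List.mem_cons, List.mem_flatMap, mem_bitEdges] at he
    rcases he with rfl | rfl | ⟨c, hc, ⟨-, rfl⟩ | ⟨-, rfl⟩⟩ <;> simp
  refine List.nodup_cons.2 ⟨?_, List.nodup_append'.2 ⟨?_, ?_, ?_⟩⟩
  · simp only [List.mem_append, List.mem_flatMap, List.mem_range, not_or, not_exists, not_and,
      coordEdges, List.mem_cons, Prod.mk.injEq, List.not_mem_nil, or_false]
    refine ⟨by omega, fun i hi he => ?_⟩
    have := hrow i hi _ he
    omega
  · refine List.nodup_flatMap_range (fun e => e.2 - 2) (fun c _ => ?_) fun c _ e he => ?_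
    · simp [coordEdges]
    · simp only [coordEdges, List.mem_cons, List.not_mem_nil, or_false] at he
      rcases he with rfl | rfl <;> simp
  · refine List.nodup_flatMap_range
      (fun e => if e.2 < 2 + D + N then e.2 - (2 + D) else e.2 - (2 + D + N))
      (fun i hi => rowEdges_nodup hi) fun i hi e he => ?_
    rcases hrow i hi e he with h | h <;> rw [h] <;> split <;> omega
  · intro e he he'
    obtain ⟨c, hc, he⟩ := List.mem_flatMap.1 he
    obtain ⟨i, hi, he'⟩ := List.mem_flatMap.1 he'
    have h1 := hrow i (List.mem_range.1 hi) e he'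
    have h2 := List.mem_range.1 hc
    simp only [coordEdges, List.mem_cons, List.not_mem_nil, or_false] at he
    rcases he with rfl | rfl <;> dsimp at h1 <;> omega

theorem List.length_flatMap_range_le {β : Type*} (f : ℕ → List β) {L : ℕ} (k : ℕ)
    (hf : ∀ i, (f i).length ≤ L) : ((List.range k).flatMap f).length ≤ k * L := by
  induction k with
  | zero => simp
  | succ k ih =>
    simp only [List.range_succ, List.flatMap_append, List.length_append, List.flatMap_singleton]
    rw [add_mul]
    have := hf k
    omega

theorem rowEdges_length_le (k i : ℕ) : (rowEdges N D U V k i).length ≤ 2 + k * 2 := by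
  have := List.length_flatMap_range_le (bitEdges N D U V i) (L := 2) k fun c => by
    unfold bitEdges
    split <;> split <;> simp
  simp only [rowEdges, List.length_cons]
  omega

theorem coordEdges_flatMap_length_le (k : ℕ) :
    ((List.range k).flatMap coordEdges).length ≤ k * 2 :=
  List.length_flatMap_range_le coordEdges k fun c => by simp [coordEdges]

theorem rowEdges_flatMap_length_le (k : ℕ) :
    ((List.range k).flatMap (rowEdges N D U V D)).length ≤ k * (2 + D * 2) :=
  List.length_flatMap_range_le _ k fun i => rowEdges_length_le D i

theorem vectorEdges_length_le : (vectorEdges N D U V).length ≤ 1 + D * 2 + N * (2 + D * 2) := by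
  have h1 := coordEdges_flatMap_length_le D
  have h2 := rowEdges_flatMap_length_le (N := N) (D := D) (U := U) (V := V) N
  simp only [vectorEdges, List.length_cons, List.length_append]
  omega

end

/-- The graph with the edges `vectorEdges N D U V`. -/
def vectorGraph (N D : ℕ) (U V : ℕ → ℕ → Bool) : GraphInput :=
  .ofPairs (2 + D + 2 * N) (vectorEdges N D U V) vectorEdges_lt vectorEdges_nodup

/-! ### The diameter of the orthogonal vectors graph -/

section

variable {N D : ℕ} {U V : ℕ → ℕ → Bool}

/-- For nonadjacent `u` and `v` one of the centers is a common neighbour, except for a vector of the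
first side against one of the second. The exceptional pairs form the last alternative. -/
theorem vectorEdges_connect (u v : ℕ) (huv : u < v) (hv : v < 2 + D + 2 * N) :
    (u, v) ∈ vectorEdges N D U V ∨
    (∃ z < 2 + D + 2 * N, ((u, z) ∈ vectorEdges N D U V ∨ (z, u) ∈ vectorEdges N D U V) ∧
      ((z, v) ∈ vectorEdges N D U V ∨ (v, z) ∈ vectorEdges N D U V)) ∨
    ∃ i < N, ∃ j < N, u = 2 + D + i ∧ v = 2 + D + N + j := by
  have e01 : (0, 1) ∈ vectorEdges N D U V := mem_vectorEdges.2 (.inl rfl)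
  have ec : ∀ c, 2 ≤ c → c < 2 + D → (0, c) ∈ vectorEdges N D U V ∧
      (1, c) ∈ vectorEdges N D U V := by
    intro c h1 h2
    obtain ⟨c, rfl⟩ := Nat.exists_eq_add_of_le h1
    exact ⟨mem_vectorEdges.2 (.inr (.inl ⟨c, by omega, .inl rfl⟩)),
      mem_vectorEdges.2 (.inr (.inl ⟨c, by omega, .inr rfl⟩))⟩
  have ea : ∀ a, 2 + D ≤ a → a < 2 + D + N → (0, a) ∈ vectorEdges N D U V := by
    intro a h1 h2
    obtain ⟨i, rfl⟩ := Nat.exists_eq_add_of_le h1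
    exact mem_vectorEdges.2 (.inr (.inr ⟨i, by omega, .inl rfl⟩))
  have eb : ∀ b, 2 + D + N ≤ b → b < 2 + D + 2 * N → (1, b) ∈ vectorEdges N D U V := by
    intro a h1 h2
    obtain ⟨i, rfl⟩ := Nat.exists_eq_add_of_le h1
    exact mem_vectorEdges.2 (.inr (.inr ⟨i, by omega, .inr (.inl rfl)⟩))
  have e0 : ∀ a, 1 ≤ a → a < 2 + D + N → (0, a) ∈ vectorEdges N D U V := by
    intro a h1 h2
    rcases (show a = 1 ∨ 2 ≤ a by omega) with rfl | h3
    · exact e01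
    · rcases lt_or_ge a (2 + D) with h4 | h4
      · exact (ec a h3 h4).1
      · exact ea a h4 h2
  have e1 : ∀ a, 2 ≤ a → a < 2 + D ∨ 2 + D + N ≤ a → a < 2 + D + 2 * N →
      (1, a) ∈ vectorEdges N D U V := by
    intro a h1 h2 h3
    rcases h2 with h2 | h2
    · exact (ec a h1 h2).2
    · exact eb a h2 h3
  rcases lt_or_ge v (2 + D + N) with h | h
  · rcases Nat.eq_zero_or_pos u with rfl | hu
    · exact .inl (e0 v huv h)
    · exact .inr (.inl ⟨0, by omega, .inr (e0 u hu (by omega)), .inl (e0 v (by omega) h)⟩)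
  · rcases (show u = 0 ∨ u = 1 ∨ (2 ≤ u ∧ (u < 2 + D ∨ 2 + D + N ≤ u)) ∨
      (2 + D ≤ u ∧ u < 2 + D + N) by omega) with rfl | rfl | hu | hu
    · exact .inr (.inl ⟨1, by omega, .inl e01, .inl (e1 v (by omega) (.inr h) hv)⟩)
    · exact .inl (e1 v (by omega) (.inr h) hv)
    · exact .inr (.inl ⟨1, by omega, .inr (e1 u hu.1 hu.2 (by omega)),
        .inl (e1 v (by omega) (.inr h) hv)⟩)
    · exact .inr (.inr ⟨u - (2 + D), by omega, v - (2 + D + N), by omega, by omega, by omega⟩)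

theorem vectorGraph_ediam_eq_three {i j : ℕ} (hi : i < N) (hj : j < N)
    (h : ∀ c < D, ¬ (U i c ∧ V j c)) : (vectorGraph N D U V).graph.ediam = 3 := by
  refine le_antisymm (GraphInput.ofPairs_ediam_le_three fun u v huv hv => ?_)
    (GraphInput.three_le_ofPairs_ediam (u := 2 + D + i) (v := 2 + D + N + j) (by omega) (by omega)
      ?_ ?_)
  · rcases vectorEdges_connect (U := U) (V := V) u v huv hv with h | h | ⟨i, hi, j, hj, rfl, rfl⟩
    · exact .inl h
    · exact .inr (.inl h)
    -- The path from a first-side vector to a second-side vector through both centers.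
    · refine .inr (.inr ⟨0, by omega, 1, by omega, .inr ?_, .inl ?_, .inl ?_⟩)
      · exact mem_vectorEdges.2 (.inr (.inr ⟨i, hi, .inl rfl⟩))
      · exact mem_vectorEdges.2 (.inl rfl)
      · exact mem_vectorEdges.2 (.inr (.inr ⟨j, hj, .inr (.inl rfl)⟩))
  · rw [mem_vectorEdges]
    simp only [Prod.mk.injEq]
    rintro (h | ⟨c, hc, h⟩ | ⟨i', hi', h | h | ⟨c, hc, h | h⟩⟩) <;> omega
  · intro z hz
    -- The neighbours of a first-side vector are the center 0 and the coordinates at which it is 1.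
    -- The former is never adjacent to a second-side vector, the latter are not adjacent to vector
    -- `j` by orthogonality.
    have hz' : z = 0 ∨ ∃ c < D, z = 2 + c ∧ U i c := by
      simp only [mem_vectorEdges, Prod.mk.injEq] at hz
      rcases hz with (h | ⟨c, hc, h⟩ | ⟨i', hi', h | h | ⟨c, hc, h | h⟩⟩) |
        (h | ⟨c, hc, h⟩ | ⟨i', hi', h | h | ⟨c, hc, h | h⟩⟩)
      any_goals omega
      obtain rfl : i = i' := by omega
      exact .inr ⟨c, hc, h.2.1, h.1⟩
    constructor
    · intro hz
      simp only [mem_vectorEdges, Prod.mk.injEq] at hz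
      rcases hz' with rfl | ⟨c, hc, rfl, hU⟩
      · rcases hz with (h | ⟨c, hc, h⟩ | ⟨i', hi', h | h | ⟨c, hc, h | h⟩⟩) <;> omega
      · rcases hz with (h | ⟨c, hc, h⟩ | ⟨i', hi', h | h | ⟨c', hc', h' | h'⟩⟩)
        any_goals omega
        obtain rfl : c = c' := by omega
        obtain rfl : j = i' := by omega
        exact h c hc ⟨hU, h'.1⟩
    · intro hz
      have := vectorEdges_lt _ hz
      dsimp at this
      rcases hz' with rfl | ⟨c, hc, rfl, hU⟩ <;> omega

theorem vectorGraph_ediam_eq_two (hN : 0 < N)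
    (h : ∀ i < N, ∀ j < N, ∃ c < D, U i c ∧ V j c) : (vectorGraph N D U V).graph.ediam = 2 := by
  -- The center 1 and `2 + D`, the first vector of the first side, are not adjacent. Such a vector
  -- exists because `0 < N`.
  refine le_antisymm (GraphInput.ofPairs_ediam_le_two fun u v huv hv => ?_)
    (GraphInput.two_le_ofPairs_ediam (u := 1) (v := 2 + D) (by omega) (by omega) ?_)
  · rcases vectorEdges_connect (U := U) (V := V) u v huv hv with h' | h' | ⟨i, hi, j, hj, rfl, rfl⟩
    · exact .inl h'
    · exact .inr h'
    · obtain ⟨c, hc, h1, h2⟩ := h i hi j hj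
      exact .inr ⟨2 + c, by omega,
        .inr (mem_vectorEdges.2 (.inr (.inr ⟨i, hi, .inr (.inr ⟨c, hc, .inl ⟨h1, rfl⟩⟩)⟩))),
        .inl (mem_vectorEdges.2 (.inr (.inr ⟨j, hj, .inr (.inr ⟨c, hc, .inr ⟨h2, rfl⟩⟩)⟩)))⟩
  · rw [mem_vectorEdges]
    simp only [Prod.mk.injEq]
    rintro (h | ⟨c, hc, h⟩ | ⟨i', hi', h | h | ⟨c, hc, h | h⟩⟩) <;> omega

theorem vectorGraph_ediam (hN : 0 < N) :
    (vectorGraph N D U V).graph.ediam = 2 ∨ (vectorGraph N D U V).graph.ediam = 3 := by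
  by_cases h : ∀ i < N, ∀ j < N, ∃ c < D, U i c ∧ V j c
  · exact .inl (vectorGraph_ediam_eq_two hN h)
  · push Not at h
    obtain ⟨i, hi, j, hj, h⟩ := h
    exact .inr (vectorGraph_ediam_eq_three hi hj fun c hc h' => h c hc h'.1 h'.2)

theorem vectorGraph_ediam_eq_three_iff (hN : 0 < N) : (vectorGraph N D U V).graph.ediam = 3 ↔
    ∃ i < N, ∃ j < N, ∀ c < D, ¬ (U i c ∧ V j c) := by
  constructor
  · intro h3
    by_contra! h
    have := vectorGraph_ediam_eq_two hN (U := U) (V := V) fun i hi j hj => by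
      obtain ⟨c, hc, h1⟩ := h i hi j hj
      exact ⟨c, hc, h1⟩
    rw [this] at h3
    norm_num at h3
  · rintro ⟨i, hi, j, hj, h⟩
    exact vectorGraph_ediam_eq_three hi hj h

end

/-! ### Distinguishing diameters two and three takes linear time -/

/-- The edges of the tree in which vertex `i + 1` is attached to vertex `f i`, for `i < k`. -/
def starEdges (k : ℕ) (f : ℕ → ℕ) : List (ℕ × ℕ) := (List.range k).map fun i => (f i, i + 1)

theorem mem_starEdges {k : ℕ} {f : ℕ → ℕ} {u v : ℕ} :
    (u, v) ∈ starEdges k f ↔ ∃ i < k, f i = u ∧ i + 1 = v := by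
  simp [starEdges]

theorem starEdges_lt {k : ℕ} {f : ℕ → ℕ} (hf : ∀ i, f i ≤ i) :
    ∀ e ∈ starEdges k f, e.1 < e.2 ∧ e.2 < k + 1 := by
  rintro ⟨u, v⟩ he
  obtain ⟨i, hi, rfl, rfl⟩ := mem_starEdges.1 he
  have := hf i
  dsimp
  omega

theorem starEdges_nodup {k : ℕ} {f : ℕ → ℕ} : (starEdges k f).Nodup :=
  List.nodup_range.map fun i j h => by simpa using (Prod.mk.inj h).2

/-- The tree in which vertex `i + 1` is attached to vertex `f i`. -/
def starGraph (k : ℕ) (f : ℕ → ℕ) (hf : ∀ i, f i ≤ i) : GraphInput :=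
  .ofPairs (k + 1) (starEdges k f) (starEdges_lt hf) starEdges_nodup

theorem starGraph_ediam_eq_two {k : ℕ} (hk : 2 ≤ k) :
    (starGraph k (fun _ => 0) fun _ => Nat.zero_le _).graph.ediam = 2 := by
  refine le_antisymm (GraphInput.ofPairs_ediam_le_two fun u v huv hv => ?_)
    (GraphInput.two_le_ofPairs_ediam (u := 1) (v := 2) (by omega) (by omega) ?_)
  · simp only [mem_starEdges]
    rcases Nat.eq_zero_or_pos u with rfl | hu
    · exact .inl ⟨v - 1, by omega, rfl, by omega⟩
    · exact .inr ⟨0, by omega, .inr ⟨u - 1, by omega, rfl, by omega⟩,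
        .inl ⟨v - 1, by omega, rfl, by omega⟩⟩
  · simp [mem_starEdges]

/-- Vertex `j + 1` hangs from the leaf 1 instead of the center 0, which puts it at distance 3 from
every other leaf of the center. -/
theorem starGraph_ediam_eq_three {k j : ℕ} (hk : 3 ≤ k) (hj : 0 < j) (hjk : j < k)
    (hf : ∀ i, (if i = j then 1 else 0) ≤ i) :
    (starGraph k (fun i => if i = j then 1 else 0) hf).graph.ediam = 3 := by
  have e0 : ∀ v, 0 < v → v < k + 1 → v ≠ j + 1 →
      (0, v) ∈ starEdges k (fun i => if i = j then 1 else 0) := fun v h1 h2 h3 =>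
    mem_starEdges.2 ⟨v - 1, by omega, if_neg (by omega), by omega⟩
  have e1 : (1, j + 1) ∈ starEdges k (fun i => if i = j then 1 else 0) :=
    mem_starEdges.2 ⟨j, hjk, if_pos rfl, rfl⟩
  have hmem : ∀ u v, (u, v) ∈ starEdges k (fun i => if i = j then 1 else 0) →
      (u = 0 ∧ v ≠ j + 1) ∨ (u = 1 ∧ v = j + 1) := by
    intro u v h
    obtain ⟨i, hi, h1, rfl⟩ := mem_starEdges.1 h
    split at h1 <;> omega
  have h3 (x y : ℕ) (hxy : x < y) (hy : y < k + 1) (hx0 : x ≠ 0) (hx1 : x ≠ 1) (hy1 : y ≠ 1)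
      (hj : x = j + 1 ∨ y = j + 1) :
      3 ≤ (starGraph k (fun i => if i = j then 1 else 0) hf).graph.ediam := by
    refine GraphInput.three_le_ofPairs_ediam hxy hy ?_ ?_
    · intro h
      have := hmem _ _ h
      omega
    · rintro z (h | h)
      · have := hmem _ _ h
        omega
      · have := hmem _ _ h
        refine ⟨fun h' => ?_, fun h' => ?_⟩
        · have := hmem _ _ h'
          omega
        · have := hmem _ _ h'
          omega
  refine le_antisymm (GraphInput.ofPairs_ediam_le_three fun u v huv hv => ?_) ?_
  · rcases Nat.eq_zero_or_pos u with rfl | hu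
    · by_cases h : v = j + 1
      · subst h
        exact .inr (.inl ⟨1, by omega, .inl (e0 1 (by omega) (by omega) (by omega)), .inl e1⟩)
      · exact .inl (e0 v huv hv h)
    · by_cases h : v = j + 1
      · subst h
        by_cases h1 : u = 1
        · subst h1; exact .inl e1
        · exact .inr (.inr ⟨0, by omega, 1, by omega, .inr (e0 u hu (by omega) (by omega)),
            .inl (e0 1 (by omega) (by omega) (by omega)), .inl e1⟩)
      · by_cases h1 : u = j + 1
        · subst h1
          exact .inr (.inr ⟨1, by omega, 0, by omega, .inr e1,
            .inr (e0 1 (by omega) (by omega) (by omega)), .inl (e0 v (by omega) hv h)⟩)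
        · exact .inr (.inl ⟨0, by omega, .inr (e0 u hu (by omega) h1),
            .inl (e0 v (by omega) hv h)⟩)
  -- The far partner of `j + 1` has to be a leaf of the center other than 1: vertex 3 if `j = 1`,
  -- and vertex 2 otherwise.
  · by_cases h : j = 1
    · subst h
      exact h3 2 3 (by omega) (by omega) (by omega) (by omega) (by omega) (by omega)
    · exact h3 2 (j + 1) (by omega) (by omega) (by omega) (by omega) (by omega) (by omega)

theorem starEdges_words_getD (k : ℕ) (f : ℕ → ℕ) (a : ℕ) :
    ((starEdges k f).flatMap fun e => [e.1, e.2]).getD a 0 =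
      if a < 2 * k then (if a % 2 = 0 then f (a / 2) else a / 2 + 1) else 0 := by
  induction k with
  | zero => simp [starEdges]
  | succ k ih =>
    have hlen : ((starEdges k f).flatMap fun e => [e.1, e.2]).length = 2 * k := by
      clear ih
      induction k with
      | zero => rfl
      | succ k ih =>
        simp only [starEdges, List.range_succ, List.map_append, List.flatMap_append,
          List.length_append] at ih ⊢
        rw [ih]
        simp
        omega
    have hs : starEdges (k + 1) f = starEdges k f ++ [(f k, k + 1)] := by
      simp [starEdges, List.range_succ]
    rw [hs, List.flatMap_append]
    rcases lt_or_ge a (2 * k) with h | h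
    · rw [List.getD_append _ _ _ _ (by omega), ih, if_pos h, if_pos (show a < 2 * (k + 1) by omega)]
    · rw [List.getD_append_right _ _ _ _ (by omega), hlen]
      obtain ⟨r, rfl⟩ := Nat.exists_eq_add_of_le h
      rw [Nat.add_sub_cancel_left]
      match r with
      | 0 => simp
      | 1 =>
        rw [if_pos (by omega), if_neg (by omega)]
        simp; omega
      | r + 2 => rw [if_neg (by omega)]; simp

/-- Adversary argument on the star with `k` edges, which has diameter 2. If fewer than `k - 1` cells
are read, some edge has a first endpoint that is never looked at. Changing that endpoint from 0 to 1
makes the diameter 3 but keeps the input length, hence the word size, and therefore the run and its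
answer. -/
theorem WordRAM.linear_le_of_solves_diameter {P : Prog} {T : ℕ → ℕ}
    (h : Solves P GraphInput.encode (fun x => x.graph.ediam = 2 ∨ x.graph.ediam = 3)
      (fun x => x.graph.ediam = 3) fun x => T x.m) {k : ℕ} (hk : 3 ≤ k) : k ≤ T k + 1 := by
  by_contra! hlt
  obtain ⟨c, h⟩ := h
  dsimp only at h
  have hm : ∀ f hf, (starGraph k f hf).m = k := fun f hf => by
    simp [starGraph, GraphInput.ofPairs_m, starEdges]
  have hlen : ∀ f hf, (starGraph k f hf).encode.length = 2 + 2 * k := fun f hf => by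
    rw [GraphInput.encode_length, hm]
  have h2 := starGraph_ediam_eq_two (k := k) (by omega)
  obtain ⟨t, s, ht, he, -, hno⟩ := h _ (.inl h2)
  rw [hm] at ht
  rw [hlen, hm] at he
  obtain ⟨R, hR, hreads⟩ := he.exists_reads
  -- Edge `j` has its first endpoint in cell `2 + 2 * j`. Edge 0 is excluded, since moving it to
  -- vertex 1 would create a loop.
  obtain ⟨j, hj, hjR⟩ : ∃ j ∈ (Finset.range k).erase 0, 2 + 2 * j ∉ R := by
    by_contra! hall
    have := Finset.card_le_card_of_injOn (fun j => 2 + 2 * j) hall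
      (fun a _ b _ hab => by dsimp at hab; omega)
    rw [Finset.card_erase_of_mem (by simp; omega), Finset.card_range] at this
    omega
  simp only [Finset.mem_erase, Finset.mem_range] at hj
  have hf : ∀ i, (if i = j then 1 else 0) ≤ i := by intro i; split <;> omega
  have h3 := starGraph_ediam_eq_three hk (by omega) hj.2 hf
  obtain ⟨t', s', ht', he', hyes, -⟩ := h _ (.inr h3)
  rw [hlen, hm] at he'
  obtain ⟨m', hsim, -⟩ := hreads
    (init (starGraph k (fun i => if i = j then 1 else 0) hf).encode).mem (by
    intro a ha
    simp only [init, starGraph, GraphInput.ofPairs_encode]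
    match a with
    | 0 => rfl
    | 1 => simp [starEdges]
    | a + 2 =>
      simp only [List.getD_cons_succ, starEdges_words_getD]
      have : a % 2 = 0 → a / 2 ≠ j := by
        rintro h1 rfl
        exact hjR (by rwa [show 2 + 2 * (a / 2) = a + 2 by omega])
      by_cases h1 : a % 2 = 0
      · simp [h1, this h1]
      · simp [h1])
  have := he'.deterministic hsim
  have h1 := hyes h3
  have h0 := hno (by rw [h2]; norm_num)
  rw [this] at h1
  dsimp at h1
  omega

namespace WordRAM

/-! ### The program that writes the graph of an orthogonal vectors instance -/

/-- The words that describe a list of edges. -/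
def words (L : List (ℕ × ℕ)) : List ℕ := L.flatMap fun e => [e.1, e.2]

theorem words_length (L : List (ℕ × ℕ)) : (words L).length = 2 * L.length := by
  induction L with
  | nil => rfl
  | cons e L ih =>
    simp only [words, List.flatMap_cons, List.length_append, List.length_cons] at ih ⊢
    rw [ih]
    simp; omega

/-- Add one to a register (register 5 holds 1). -/
def incr (r : ℕ) : Prog := .op .add r r 5

/-- Subtract one from a register (register 5 holds 1). -/
def decr (r : ℕ) : Prog := .op .sub r r 5

/-- Copy a register (register 0 holds 0). -/
def move (r a : ℕ) : Prog := .op .add r a 0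

/-- Write register `a` to the output; register 6 is the output pointer. -/
def push (a : ℕ) : Prog := .seq (.store 6 a) (incr 6)

/-- Register 1 holds `N`, 2 holds `D`, 3 the table position, 4 the start of the graph and 6 the
output position; 7 and 10 count rows and coordinates; 8, 9 and 11 hold the vertices of the two
vectors and of the coordinate. The number of edges is not known yet, so a 0 is written in its place.
-/
def graphHeader : Prog := block
  [.const 0 0, .const 5 1, .op .mul 12 1 2, .op .add 12 12 12, .op .add 4 3 12,
    .op .add 12 1 1, .op .add 12 12 2, incr 12, incr 12,
    move 6 4, push 12, push 0, push 0, push 5, .const 11 2, move 10 2]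

def coordBody : Prog := block [push 0, push 11, push 5, push 11, incr 11, decr 10]

def bitBody : Prog := block
  [.load 12 3, incr 3, .branch 12 (block [push 11, push 8]) .skip,
    .load 12 3, incr 3, .branch 12 (block [push 11, push 9]) .skip, incr 11, decr 10]

def rowHeader : Prog := block [push 0, push 8, push 5, push 9, .const 11 2, move 10 2]

def rowFooter : Prog := block [incr 8, incr 9, decr 7]

/-- The finished output has two words per edge and two more in front, so half its length minus one
is the missing edge count, which goes into the second word. -/
def graphFooter : Prog := block
  [.op .sub 12 6 4, .op .shr 12 12 5, decr 12, .op .add 13 4 5, .store 13 12]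

/-- Write the graph behind the table. -/
def graphProg : Prog :=
  .seq graphHeader <| .seq (.loop 10 coordBody) <|
  .seq (block [move 8 11, .op .add 9 8 1, move 7 1]) <|
  .seq (.loop 7 (.seq rowHeader <| .seq (.loop 10 bitBody) rowFooter)) graphFooter

theorem update_lay_two {low base} {out : List ℕ} {p : ℕ} (h : p = base + out.length) (u v : ℕ) :
    Function.update (Function.update (lay low base out) p u) (p + 1) v =
      lay low base (out ++ [u, v]) := by
  rw [update_lay h, update_lay (by simp; omega)]
  simp

/-! ### Execution and running time of the graph-writing program -/

section

variable {w N D tb : ℕ} {low : ℕ → ℕ} {tab : List ℕ}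

theorem ex_coordBody {z₇ z₈ z₉ z₁₂ z₁₃ z₁₄ z₁₅ z₁₆ z₁₇ B : ℕ} {pre : List ℕ}
    (hw : B + (pre.length + 4 * D) + D + 3 < 2 ^ w) :
    Ex w (.loop 10 coordBody)
      [0, N, D, tb, B, 1, B + pre.length, z₇, z₈, z₉, D, 2, z₁₂, z₁₃, z₁₄, z₁₅, z₁₆, z₁₇]
      (lay low B pre) (D * (11 + 1) + 1) fun l m =>
      ∃ out, out = pre ++ words ((List.range D).flatMap coordEdges) ∧
      l = [0, N, D, tb, B, 1, B + out.length, z₇, z₈, z₉, 0, 2 + D,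
        z₁₂, z₁₃, z₁₄, z₁₅, z₁₆, z₁₇] ∧ m = lay low B out := by
  refine (Ex.for D 11 (fun c l m => ∃ out, out = pre ++ words ((List.range c).flatMap coordEdges) ∧
      l = [0, N, D, tb, B, 1, B + out.length, z₇, z₈, z₉, D - c, 2 + c,
        z₁₂, z₁₃, z₁₄, z₁₅, z₁₆, z₁₇] ∧ m = lay low B out) ?_ ?_ ?_).mono le_rfl ?_
  · rintro i l m ⟨out, -, rfl, rfl⟩; rfl
  · rintro c l m hc ⟨out, hout, rfl, rfl⟩
    refine (Ex.of_wp ?_).mono (T := cost coordBody) (by decide) fun _ _ h => h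
    have h1 := coordEdges_flatMap_length_le c
    have h2 := words_length ((List.range c).flatMap coordEdges)
    have h3 : out.length ≤ pre.length + 4 * c := by rw [hout, List.length_append]; omega
    have h4 : out ++ [0, 2 + c] ++ [1, 2 + c] =
        pre ++ words ((List.range (c + 1)).flatMap coordEdges) := by
      simp [hout, List.range_succ, coordEdges, words]
    simp only [coordBody, block, push, incr, decr, wp, BinOp.eval, List.getD_cons_succ,
      List.getD_cons_zero, List.set_cons_succ, List.set_cons_zero, List.length_cons,
      List.length_nil]
    and_intros
    any_goals omega
    refine ⟨_, h4, ?_, ?_⟩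
    · simp only [List.cons.injEq, List.length_append, List.length_cons, List.length_nil,
        true_and, and_true]
      omega
    · rw [update_lay_two rfl, update_lay_two]
      simp only [List.length_append, List.length_cons, List.length_nil]
      omega
  · exact ⟨pre, by simp [words], by simp, rfl⟩
  · rintro l m ⟨out, h, rfl, rfl⟩
    exact ⟨out, h, by simp, rfl⟩

variable {U V : ℕ → ℕ → Bool}

/-- The table lists the bits of the vectors row by row, those of the two sides alternating. -/
def IsTable (N D : ℕ) (U V : ℕ → ℕ → Bool) (tab : List ℕ) : Prop :=
  tab.length = 2 * (N * D) ∧ ∀ i < N, ∀ c < D, tab.getD (2 * (i * D + c)) 0 = (U i c).toNat ∧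
    tab.getD (2 * (i * D + c) + 1) 0 = (V i c).toNat

/-- The table lies entirely below `B`, so edges appended from `B` on never disturb the bits still to
be read. -/
theorem ex_bitBody {z₇ z₁₂ z₁₃ z₁₄ z₁₅ z₁₆ z₁₇ B i : ℕ} {pre : List ℕ}
    (ht : IsTable N D U V tab) (hB : B = tb + tab.length) (hi : i < N)
    (hw : B + (pre.length + 4 * D) + 2 * (N * D) + D + 2 * N + 4 < 2 ^ w) :
    Ex w (.loop 10 bitBody)
      [0, N, D, tb + 2 * (i * D), B, 1, B + pre.length, z₇, 2 + D + i, 2 + D + N + i, D, 2,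
        z₁₂, z₁₃, z₁₄, z₁₅, z₁₆, z₁₇]
      (lay (lay low tb tab) B pre) (D * (19 + 1) + 1) fun l m =>
      ∃ out y, out = pre ++ words ((List.range D).flatMap (bitEdges N D U V i)) ∧
      l = [0, N, D, tb + 2 * (i * D + D), B, 1, B + out.length, z₇, 2 + D + i, 2 + D + N + i, 0,
        2 + D, y, z₁₃, z₁₄, z₁₅, z₁₆, z₁₇] ∧ m = lay (lay low tb tab) B out := by
  refine (Ex.for D 19 (fun c l m => ∃ out y,
      out = pre ++ words ((List.range c).flatMap (bitEdges N D U V i)) ∧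
      l = [0, N, D, tb + 2 * (i * D + c), B, 1, B + out.length, z₇, 2 + D + i, 2 + D + N + i,
        D - c, 2 + c, y, z₁₃, z₁₄, z₁₅, z₁₆, z₁₇] ∧ m = lay (lay low tb tab) B out)
      ?_ ?_ ?_).mono le_rfl ?_
  · rintro i l m ⟨out, y, -, rfl, rfl⟩; rfl
  · rintro c l m hc ⟨out, y, hout, rfl, rfl⟩
    refine (Ex.of_wp ?_).mono (T := cost bitBody) (by decide) fun _ _ h => h
    have h1 := rowEdges_length_le (N := N) (D := D) (U := U) (V := V) c i
    have h2 := words_length ((List.range c).flatMap (bitEdges N D U V i))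
    simp only [rowEdges, List.length_cons] at h1
    have h3 : out.length ≤ pre.length + 4 * c := by rw [hout, List.length_append]; omega
    have h4 : (i + 1) * D ≤ N * D := Nat.mul_le_mul_right D hi
    rw [add_mul, one_mul] at h4
    obtain ⟨hU, hV⟩ := ht.2 i hi c hc
    have h5 : lay (lay low tb tab) B out (tb + 2 * (i * D + c)) = (U i c).toNat := by
      rw [lay_of_lt (by rw [hB, ht.1]; omega), lay_add, hU]
    have h6 : ∀ out, lay (lay low tb tab) B out (tb + 2 * (i * D + c) + 1) = (V i c).toNat := by
      intro out
      rw [lay_of_lt (by rw [hB, ht.1]; omega), add_assoc, lay_add, hV]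
    have h7 : pre ++ words ((List.range (c + 1)).flatMap (bitEdges N D U V i)) =
        out ++ words (bitEdges N D U V i c) := by
      simp [hout, List.range_succ, words]
    have h8 := (U i c).toNat_le
    have h9 := (V i c).toNat_le
    simp only [h7]
    simp only [bitBody, block, push, incr, decr, wp, BinOp.eval, List.getD_cons_succ,
      List.getD_cons_zero, List.set_cons_succ, List.set_cons_zero, List.length_cons,
      List.length_nil, h5, update_lay_two rfl, h6, bitEdges]
    cases hu : U i c <;> cases hv : V i c <;>
    simp only [Bool.toNat_true, Bool.toNat_false, ne_eq, not_true_eq_false, one_ne_zero,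
      false_implies, true_implies, not_false_eq_true, if_true, and_true, true_and]
    all_goals
      and_intros
      any_goals omega
      refine ⟨_, (V i c).toNat, rfl, ?_, ?_⟩
      · simp only [hv, Bool.toNat_true, Bool.toNat_false, List.cons.injEq, List.length_append,
          List.length_cons, List.length_nil, words,
          List.flatMap_cons, List.flatMap_nil, true_and, and_true, Bool.false_eq_true, if_false,
          List.cons_append, List.nil_append]
        omega
      · try rw [update_lay_two (by simp; omega)]
        simp [words]
  · exact ⟨pre, z₁₂, by simp [words], by simp, rfl⟩
  · rintro l m ⟨out, y, h, rfl, rfl⟩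
    exact ⟨out, y, h, by simp, rfl⟩


theorem ex_rows {z₈ z₁₀ z₁₁ z₁₂ z₁₃ z₁₄ z₁₅ z₁₆ z₁₇ B : ℕ} {pre : List ℕ}
    (ht : IsTable N D U V tab) (hB : B = tb + tab.length)
    (hw : B + (pre.length + 4 * (N * D) + 4 * N) + 2 * (N * D) + D + 2 * N + 4 < 2 ^ w)
    (hz : z₈ = 2 + D) :
    Ex w (.loop 7 (.seq rowHeader <| .seq (.loop 10 bitBody) rowFooter))
      [0, N, D, tb, B, 1, B + pre.length, N, z₈, 2 + D + N, z₁₀, z₁₁, z₁₂, z₁₃, z₁₄, z₁₅, z₁₆, z₁₇]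
      (lay (lay low tb tab) B pre) (N * ((11 + ((D * (19 + 1) + 1) + 4)) + 1) + 1) fun l m =>
      ∃ out x₁₀ x₁₁ x₁₂, out = pre ++ words ((List.range N).flatMap (rowEdges N D U V D)) ∧
      l = [0, N, D, tb + 2 * (N * D), B, 1, B + out.length, 0, 2 + D + N, 2 + D + N + N,
        x₁₀, x₁₁, x₁₂, z₁₃, z₁₄, z₁₅, z₁₆, z₁₇] ∧ m = lay (lay low tb tab) B out := by
  refine (Ex.for N _ (fun i l m => ∃ out x₁₀ x₁₁ x₁₂,
      out = pre ++ words ((List.range i).flatMap (rowEdges N D U V D)) ∧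
      l = [0, N, D, tb + 2 * (i * D), B, 1, B + out.length, N - i, 2 + D + i, 2 + D + N + i,
        x₁₀, x₁₁, x₁₂, z₁₃, z₁₄, z₁₅, z₁₆, z₁₇] ∧ m = lay (lay low tb tab) B out)
      ?_ ?_ ?_).mono le_rfl ?_
  · rintro i l m ⟨out, x₁₀, x₁₁, x₁₂, -, rfl, rfl⟩; rfl
  · rintro i l m hi ⟨out, x₁₀, x₁₁, x₁₂, hout, rfl, rfl⟩
    have h1 := rowEdges_flatMap_length_le (N := N) (D := D) (U := U) (V := V) i
    have h2 := words_length ((List.range i).flatMap (rowEdges N D U V D))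
    have h3 : out.length ≤ pre.length + 4 * (i * D) + 4 * i := by
      rw [hout, List.length_append]
      have : i * (2 + D * 2) = 2 * i + 2 * (i * D) := by ring
      omega
    have h4 : (i + 1) * D ≤ N * D := Nat.mul_le_mul_right D hi
    rw [add_mul, one_mul] at h4
    refine Ex.seq (R := fun l m => ∃ out', out' = out ++ [0, 2 + D + i] ++ [1, 2 + D + N + i] ∧
      l = [0, N, D, tb + 2 * (i * D), B, 1, B + out'.length, N - i, 2 + D + i, 2 + D + N + i,
        D, 2, x₁₂, z₁₃, z₁₄, z₁₅, z₁₆, z₁₇] ∧ m = lay (lay low tb tab) B out') ?_ ?_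
    · refine (Ex.of_wp ?_).mono (T := cost rowHeader) (by decide) fun _ _ h => h
      simp only [rowHeader, block, push, incr, move, wp, BinOp.eval, List.getD_cons_succ,
        List.getD_cons_zero, List.set_cons_succ, List.set_cons_zero, List.length_cons,
        List.length_nil, update_lay_two rfl]
      and_intros
      any_goals omega
      refine ⟨_, rfl, ?_, ?_⟩
      · simp only [List.cons.injEq, List.length_append, List.length_cons, List.length_nil,
          true_and, and_true]
        omega
      · rw [update_lay_two]
        simp only [List.length_append, List.length_cons, List.length_nil]
        omega
    · rintro l m ⟨out', hout', rfl, rfl⟩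
      have h5 : out'.length = out.length + 4 := by rw [hout']; simp
      refine Ex.seq (ex_bitBody ht hB hi (by omega)) ?_
      rintro l m ⟨out'', y, hout'', rfl, rfl⟩
      refine (Ex.of_wp ?_).mono (T := cost rowFooter) (by decide) fun _ _ h => h
      simp only [rowFooter, block, incr, decr, wp, BinOp.eval, List.getD_cons_succ,
        List.getD_cons_zero, List.set_cons_succ, List.set_cons_zero, List.length_cons,
        List.length_nil]
      and_intros
      any_goals omega
      refine ⟨out'', 0, 2 + D, y, ?_, ?_, rfl⟩
      · rw [hout'', hout', hout]
        simp [List.range_succ, words, rowEdges]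
      · simp only [List.cons.injEq, add_mul, true_and, and_true]
        omega
  · exact ⟨pre, z₁₀, z₁₁, z₁₂, by simp [words], by simp [hz], rfl⟩
  · rintro l m ⟨out, x₁₀, x₁₁, x₁₂, h, rfl, rfl⟩
    exact ⟨out, x₁₀, x₁₁, x₁₂, h, by simp, rfl⟩

theorem ex_graphProg {z₀ z₄ z₅ z₆ z₇ z₈ z₉ z₁₀ z₁₁ z₁₂ z₁₃ z₁₄ z₁₅ z₁₆ z₁₇ : ℕ}
    (ht : IsTable N D U V tab) (hw : tb + 10 * (N * D) + 10 * N + 10 * D + 20 < 2 ^ w) :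
    Ex w graphProg
      [z₀, N, D, tb, z₄, z₅, z₆, z₇, z₈, z₉, z₁₀, z₁₁, z₁₂, z₁₃, z₁₄, z₁₅, z₁₆, z₁₇]
      (lay low tb tab) (20 * (N * D) + 20 * N + 20 * D + 50) fun l m =>
      l.length = 18 ∧ l.getD 4 0 = tb + tab.length ∧
      m = lay (lay low tb tab) (tb + tab.length) (vectorGraph N D U V).encode := by
  obtain ⟨B, hB⟩ : ∃ B, B = tb + tab.length := ⟨_, rfl⟩
  have hB' := hB
  rw [ht.1] at hB'
  have hlen := vectorEdges_length_le (N := N) (D := D) (U := U) (V := V)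
  rw [← hB, vectorGraph, GraphInput.ofPairs_encode]
  have hND : N * (2 + D * 2) = 2 * N + 2 * (N * D) := by ring
  have hpre := coordEdges_flatMap_length_le D
  have hpre' := words_length ((List.range D).flatMap coordEdges)
  refine Ex.mono (T := cost graphHeader + ((D * (11 + 1) + 1) + (4 +
    (N * ((11 + ((D * (19 + 1) + 1) + 4)) + 1) + 1 + 6)))) ?_ ?_ fun _ _ h => h
  · refine Ex.seq (R := fun l m => ∃ out x₁₂, out = [2 + D + 2 * N, 0] ++ [0, 1] ∧
        l = [0, N, D, tb, B, 1, B + out.length, z₇, z₈, z₉, D, 2, x₁₂, z₁₃, z₁₄, z₁₅, z₁₆, z₁₇] ∧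
        m = lay (lay low tb tab) B out) ?_ ?_
    · refine (Ex.of_wp ?_)
      simp only [graphHeader, block, push, incr, move, wp, BinOp.eval, List.getD_cons_succ,
        List.getD_cons_zero, List.set_cons_succ, List.set_cons_zero, List.length_cons,
        List.length_nil]
      and_intros
      any_goals omega
      refine ⟨_, N + N + D + 1 + 1, rfl, ?_, ?_⟩
      · simp only [List.cons.injEq, List.length_append, List.length_cons, List.length_nil,
          true_and, and_true]
        omega
      · rw [show tb + (N * D + N * D) + 0 = B by omega,
          show N + N + D + 1 + 1 = 2 + D + 2 * N by omega]
        nth_rw 1 [lay_nil_lay hB.ge]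
        rw [update_lay_two (by simp), update_lay_two (by simp)]
        rfl
    rintro l m ⟨out, x₁₂, hout, rfl, rfl⟩
    have h1 : out.length = 4 := by rw [hout]; rfl
    refine Ex.seq (ex_coordBody (by omega)) ?_
    rintro l m ⟨out', hout', rfl, rfl⟩
    have h2 : out'.length ≤ 4 + 4 * D := by rw [hout', List.length_append]; omega
    refine Ex.seq (R := fun l m => l = [0, N, D, tb, B, 1, B + out'.length, N, 2 + D, 2 + D + N,
        0, 2 + D, x₁₂, z₁₃, z₁₄, z₁₅, z₁₆, z₁₇] ∧ m = lay (lay low tb tab) B out') ?_ ?_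
    · refine (Ex.of_wp ?_)
      simp only [block, move, wp, BinOp.eval, List.getD_cons_succ,
        List.getD_cons_zero, List.set_cons_succ, List.set_cons_zero, List.length_cons,
        List.length_nil]
      and_intros
      any_goals omega
      all_goals trivial
    rintro l m ⟨rfl, rfl⟩
    refine Ex.seq (ex_rows ht hB (by omega) rfl) ?_
    rintro l m ⟨out'', x₁₀, x₁₁, x₁₂, hout'', rfl, rfl⟩
    have h3 : out'' = (2 + D + 2 * N) :: 0 :: words (vectorEdges N D U V) := by
      rw [hout'', hout', hout]
      simp [vectorEdges, words]
    have h4 := words_length (vectorEdges N D U V)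
    have h5 : out''.length = 2 + 2 * (vectorEdges N D U V).length := by
      rw [h3, List.length_cons, List.length_cons, h4]; omega
    have h6 : (B + out''.length - B) >>> 1 - 1 = (vectorEdges N D U V).length := by
      rw [Nat.shiftRight_one]; omega
    have h7 : (B + out''.length - B) >>> 1 < 2 ^ w := by
      rw [Nat.shiftRight_one]; omega
    refine (Ex.of_wp ?_).mono (T := cost graphFooter) (by decide) fun _ _ h => h
    simp only [graphFooter, block, decr, wp, BinOp.eval, List.getD_cons_succ,
        List.getD_cons_zero, List.set_cons_succ, List.set_cons_zero, List.length_cons,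
        List.length_nil, h6]
    and_intros
    any_goals omega
    any_goals trivial
    rw [update_lay_set (by omega), h3]
    rfl
  · have : cost graphHeader ≤ 30 := by decide
    have h1 : N * ((11 + ((D * (19 + 1) + 1) + 4)) + 1) = 20 * (N * D) + 17 * N := by ring
    omega

end

end WordRAM

namespace WordRAM

/-! ### Solving orthogonal vectors with an algorithm for the diameter -/

/-- Passing from `c` to `c + 1` contributes a factor that exceeds `X`. This leaves room for a base
address `a` on top of all words of the inner machine. -/
theorem word_bound {c X Y a : ℕ} (hY : Y ≤ X) (ha : a ≤ X) :
    a < 2 ^ ((c + 1) * (Nat.log 2 X + 1)) ∧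
      a + 2 ^ (c * (Nat.log 2 Y + 1)) ≤ 2 ^ ((c + 1) * (Nat.log 2 X + 1)) := by
  have h1 : X < 2 ^ (Nat.log 2 X + 1) := Nat.lt_pow_succ_log_self (by norm_num) X
  have h2 : 2 ^ (c * (Nat.log 2 Y + 1)) ≤ 2 ^ (c * (Nat.log 2 X + 1)) :=
    Nat.pow_le_pow_right (by norm_num)
      (Nat.mul_le_mul_left c (Nat.add_le_add_right (Nat.log_mono_right hY) 1))
  have h3 : 0 < 2 ^ (c * (Nat.log 2 X + 1)) := by positivity
  rw [add_mul, one_mul, pow_add]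
  constructor <;> nlinarith

/-- Write the graph of an orthogonal vectors instance and run `P` on it. -/
def vectorProg (P : Prog) : Prog :=
  .seq graphProg (.seq (P.relocate 18 4 13) (.op .lor 0 18 18))

/-- `M` bounds input length plus running time of `P` for every edge count up to the maximum, so `T`
need not be monotone. Relocation doubles the running time, whence `2 * M`. -/
theorem exec_vectorProg {P : Prog} {T : ℕ → ℕ} {c : ℕ}
    (hP : ∀ x : GraphInput, x.graph.ediam = 2 ∨ x.graph.ediam = 3 → ∃ (t : ℕ) (s : State),
      t ≤ T x.m ∧ Exec (c * (Nat.log 2 (x.encode.length + T x.m) + 1)) P (init x.encode) t s ∧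
      (x.graph.ediam = 3 → s.reg 0 = 1) ∧ (¬ x.graph.ediam = 3 → s.reg 0 = 0))
    {N D tb : ℕ} {U V : ℕ → ℕ → Bool} {tab : List ℕ} (ht : IsTable N D U V tab) (hN : 0 < N)
    {M X : ℕ} (hM : ∀ k ≤ 1 + 2 * D + 2 * N + 2 * (N * D), 2 + 2 * k + T k ≤ M)
    (hX : M + tb + 10 * (N * D) + 10 * N + 10 * D + 20 ≤ X)
    {l : List ℕ} (hl : l.length = 18) (h1 : l.getD 1 0 = N) (h2 : l.getD 2 0 = D)
    (h3 : l.getD 3 0 = tb) (low : ℕ → ℕ) :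
    ∃ t s, t ≤ 20 * (N * D) + 20 * N + 20 * D + 51 + 2 * M ∧
      Exec ((c + 1) * (Nat.log 2 X + 1)) (vectorProg P) (st l (lay low tb tab)) t s ∧
      ((∃ i < N, ∃ j < N, ∀ k < D, ¬ (U i k ∧ V j k)) → s.reg 0 = 1) ∧
      (¬ (∃ i < N, ∃ j < N, ∀ k < D, ¬ (U i k ∧ V j k)) → s.reg 0 = 0) := by
  have hm : (vectorGraph N D U V).m ≤ 1 + 2 * D + 2 * N + 2 * (N * D) := by
    rw [vectorGraph, GraphInput.ofPairs_m]
    have := vectorEdges_length_le (N := N) (D := D) (U := U) (V := V)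
    have hND : N * (2 + D * 2) = 2 * N + 2 * (N * D) := by ring
    omega
  have hM' := hM _ hm
  obtain ⟨t₂, s₂, ht₂, he₂, hyes, hno⟩ := hP _ (vectorGraph_ediam (D := D) (U := U) (V := V) hN)
  rw [vectorGraph_ediam_eq_three_iff hN] at hyes hno
  rw [GraphInput.encode_length] at he₂
  have hw1 := (word_bound (c := c)
    (Y := 2 + 2 * (vectorGraph N D U V).m + T (vectorGraph N D U V).m)
    (a := tb + 10 * (N * D) + 10 * N + 10 * D + 20) (X := X) (by omega) (by omega)).1
  have hw2 := (word_bound (c := c)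
    (Y := 2 + 2 * (vectorGraph N D U V).m + T (vectorGraph N D U V).m)
    (a := tb + tab.length) (X := X) (by omega) (by rw [ht.1]; omega)).2
  generalize (c + 1) * (Nat.log 2 X + 1) = w at *
  have hg : Ex w graphProg l (lay low tb tab) (20 * (N * D) + 20 * N + 20 * D + 50)
      fun l m => l.length = 18 ∧ l.getD 4 0 = tb + tab.length ∧
        m = lay (lay low tb tab) (tb + tab.length) (vectorGraph N D U V).encode := by
    match l, hl with
    | [z₀, z₁, z₂, z₃, z₄, z₅, z₆, z₇, z₈, z₉, z₁₀, z₁₁, z₁₂, z₁₃, z₁₄, z₁₅, z₁₆, z₁₇], _ =>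
      simp only [List.getD_cons_succ, List.getD_cons_zero] at h1 h2 h3
      subst h1 h2 h3
      exact ex_graphProg ht hw1
  obtain ⟨t₁, l₁, m₁, ht₁, he₁, hl₁, hb, rfl⟩ := hg
  obtain ⟨t₃, s₃, ht₃, he₃, hs₃, hlt⟩ := he₂.relocate (K := 18) (b := 4) (x := 13)
    (B := tb + tab.length) (by norm_num) (by norm_num) (by norm_num) hw2
    (st l₁ (lay (lay low tb tab) (tb + tab.length) (vectorGraph N D U V).encode))
    -- Registers from 18 on are still zero and memory behind the graph is blank, which is exactly
    -- the initial state that `P` expects.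
    ⟨fun r => by
      simp only [st, init]
      exact List.getD_eq_default _ _ (by omega),
     fun a => by simp only [st, init]; rw [lay_add], hb⟩
    (fun i => by simp only [init]; positivity)
  have h18 : s₃.reg 18 = s₂.reg 0 := hs₃.reg 0
  have h0 := hlt 0
  -- `lor` of a register with itself is a copy that does not rely on another register being zero.
  have heval : BinOp.lor.eval (s₃.reg 18) (s₃.reg 18) = s₂.reg 0 := by
    simp [BinOp.eval, h18]
  have he₄ := Exec.op (w := w) .lor 0 18 18 s₃ (by rw [heval]; omega)
  rw [heval] at he₄
  refine ⟨_, _, ?_, .seq he₁ (.seq he₃ he₄), ?_, ?_⟩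
  · omega
  · intro h
    simpa [State.setReg] using hyes h
  · intro h
    simpa [State.setReg] using hno h

end WordRAM

namespace WordRAM

/-! ### Listing the bits of the vectors as a table -/

theorem _root_.List.length_flatMap_range {f : ℕ → List ℕ} {L : ℕ} (hf : ∀ i, (f i).length = L)
    (k : ℕ) :
    ((List.range k).flatMap f).length = k * L := by
  simp [List.length_flatMap, hf]

theorem _root_.List.getD_flatMap_range {f : ℕ → List ℕ} {L : ℕ} (hf : ∀ i, (f i).length = L)
    {k i r : ℕ}
    (hi : i < k) (hr : r < L) : ((List.range k).flatMap f).getD (i * L + r) 0 = (f i).getD r 0 := by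
  induction k with
  | zero => omega
  | succ k ih =>
    rw [List.range_succ, List.flatMap_append, List.flatMap_singleton]
    have hlen := List.length_flatMap_range hf k
    rcases Nat.lt_succ_iff_lt_or_eq.1 hi with h | rfl
    · have : (i + 1) * L ≤ k * L := Nat.mul_le_mul_right L h
      rw [add_mul, one_mul] at this
      rw [List.getD_append _ _ _ _ (by omega), ih h]
    · rw [List.getD_append_right _ _ _ _ (by omega), hlen, Nat.add_sub_cancel_left]

/-- A row of the table, up to coordinate `k`. -/
def tableRow (U V : ℕ → ℕ → Bool) (k i : ℕ) : List ℕ :=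
  (List.range k).flatMap fun c => [(U i c).toNat, (V i c).toNat]

theorem tableRow_length (U V : ℕ → ℕ → Bool) (k i : ℕ) : (tableRow U V k i).length = k * 2 :=
  List.length_flatMap_range (L := 2) (fun _ => rfl) k

theorem tableRow_succ (U V : ℕ → ℕ → Bool) (k i : ℕ) :
    tableRow U V (k + 1) i = tableRow U V k i ++ [(U i k).toNat, (V i k).toNat] := by
  simp [tableRow, List.range_succ]

theorem isTable_flatMap (N D : ℕ) (U V : ℕ → ℕ → Bool) :
    IsTable N D U V ((List.range N).flatMap (tableRow U V D)) := by
  refine ⟨by rw [List.length_flatMap_range (tableRow_length U V D)]; ring, fun i hi c hc => ?_⟩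
  have h (r : ℕ) (hr : r < 2) : ((List.range N).flatMap (tableRow U V D)).getD
      (2 * (i * D + c) + r) 0 = [(U i c).toNat, (V i c).toNat].getD r 0 := by
    rw [show 2 * (i * D + c) + r = i * (D * 2) + (c * 2 + r) by ring,
      List.getD_flatMap_range (tableRow_length U V D) hi (by omega), tableRow,
      List.getD_flatMap_range (L := 2) (fun _ => rfl) hc hr]
  exact ⟨h 0 (by norm_num), h 1 (by norm_num)⟩

/-! ### Satisfiability -/

/-- The first half of the variables, with values given by the bits of `i`, satisfies the clause. -/
def leftSat {n : ℕ} (h i : ℕ) (c : List (Fin n × Bool)) : Bool :=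
  c.any fun l => l.1 < h && i.testBit l.1 == l.2

/-- The second half of the variables, with values given by the bits of `i`, satisfies the clause. -/
def rightSat {n : ℕ} (h i : ℕ) (c : List (Fin n × Bool)) : Bool :=
  c.any fun l => !(l.1 < h : Bool) && i.testBit (l.1 - h) == l.2

/-- The word for a literal. -/
def litCode {n : ℕ} (l : Fin n × Bool) : ℕ := 2 * (l.1 : ℕ) + if l.2 then 1 else 0

/-- Registers 12 and 13 are flags that start at 1 and are cleared by a true literal of the first or
second half. Register 8 holds the assignment and 17 the size of the first half; 14 and 15 receive
variable and sign, decoded from the word of the literal. -/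
def litBody : Prog := block
  [.load 14 9, incr 9, .op .land 15 14 5, .op .shr 14 14 5, .op .lt 16 14 17,
    .branch 16
      (block [.op .shr 16 8 14, .op .land 16 16 5, .op .eq 16 16 15,
        .branch 16 (move 12 0) .skip])
      (block [.op .sub 14 14 17, .op .shr 16 8 14, .op .land 16 16 5, .op .eq 16 16 15,
        .branch 16 (move 13 0) .skip]),
    decr 11]

def clauseBody : Prog :=
  .seq (block [.load 11 9, incr 9, move 12 5, move 13 5]) <|
  .seq (.loop 11 litBody) (block [push 12, push 13, decr 10])

def assignmentBody : Prog :=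
  .seq (block [.const 9 2, move 10 2]) <|
  .seq (.loop 10 clauseBody) (block [incr 8, decr 7])

/-- Registers 0 and 5 hold 0 and 1 and double as the addresses of `n` and `m`. The table starts at
`(2 * n + 1) * m + 2`, a bound for the input length that is available without parsing the clauses.
-/
def satHeader : Prog := block
  [.const 0 0, .const 5 1, .load 4 0, .load 2 5, .op .add 17 4 5, .op .shr 17 17 5,
    .op .shl 1 5 17, .op .add 3 4 4, incr 3, .op .mul 3 3 2, incr 3, incr 3,
    move 6 3, move 8 0, move 7 1]

/-- Write the table of the clauses not satisfied by the assignments of either half. -/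
def satTable : Prog := .seq satHeader (.loop 7 assignmentBody)

theorem shiftRight_and_one (i v : ℕ) : (i >>> v) &&& 1 = (i.testBit v).toNat := by
  rw [Nat.and_one_is_mod, Nat.shiftRight_eq_div_pow, Nat.toNat_testBit]

theorem litCode_and_one {n : ℕ} (l : Fin n × Bool) : litCode l &&& 1 = l.2.toNat := by
  rw [Nat.and_one_is_mod, litCode]
  cases l.2 <;> simp

theorem litCode_shiftRight_one {n : ℕ} (l : Fin n × Bool) : litCode l >>> 1 = l.1 := by
  rw [Nat.shiftRight_one, litCode]
  split <;> omega

theorem _root_.Bool.toNat_eq_toNat {a b : Bool} : a.toNat = b.toNat ↔ a = b := by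
  cases a <;> cases b <;> simp

theorem ex_literals {w n N D tb p r i p₀ k h z₁₄ z₁₅ z₁₆ z₄ : ℕ} {m₀ : ℕ → ℕ}
    {cl : List (Fin n × Bool)} (hc : ∀ j (hj : j < cl.length), m₀ (p₀ + j) = litCode cl[j])
    (hp : p₀ + cl.length < 2 ^ w) (hi : i < 2 ^ w) (hn : 2 * n + 2 < 2 ^ w) :
    Ex w (.loop 11 litBody)
      [0, N, D, tb, z₄, 1, p, r, i, p₀, k, cl.length, 1, 1, z₁₄, z₁₅, z₁₆, h] m₀
      (cl.length * (20 + 1) + 1) fun l m => m = m₀ ∧ ∃ x₁₄ x₁₅ x₁₆,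
      l = [0, N, D, tb, z₄, 1, p, r, i, p₀ + cl.length, k, 0, (!leftSat h i cl).toNat,
        (!rightSat h i cl).toNat, x₁₄, x₁₅, x₁₆, h] := by
  refine (Ex.for cl.length 20 (fun j l m => m = m₀ ∧ ∃ x₁₄ x₁₅ x₁₆,
      l = [0, N, D, tb, z₄, 1, p, r, i, p₀ + j, k, cl.length - j, (!leftSat h i (cl.take j)).toNat,
        (!rightSat h i (cl.take j)).toNat, x₁₄, x₁₅, x₁₆, h]) ?_ ?_ ?_).mono le_rfl ?_
  · rintro j l m ⟨rfl, x₁₄, x₁₅, x₁₆, rfl⟩; rfl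
  · rintro j l m hj ⟨rfl, x₁₄, x₁₅, x₁₆, rfl⟩
    refine (Ex.of_wp ?_).mono (T := cost litBody) (by decide) fun _ _ h => h
    have hv := cl[j].1.2
    have hs : ∀ v, i >>> v ≤ i := fun v => Nat.shiftRight_le i v
    have hcode : litCode cl[j] < 2 ^ w := by
      rw [litCode]; split <;> omega
    have hb : cl[j].2.toNat ≤ 1 := cl[j].2.toNat_le
    have hL : leftSat h i (cl.take (j + 1)) = (leftSat h i (cl.take j) ||
        (cl[j].1 < h && i.testBit cl[j].1 == cl[j].2)) := by
      rw [leftSat, List.take_succ_eq_append_getElem hj, List.any_append]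
      simp [leftSat]
    have hR : rightSat h i (cl.take (j + 1)) = (rightSat h i (cl.take j) ||
        (!(cl[j].1 < h : Bool) && i.testBit (cl[j].1 - h) == cl[j].2)) := by
      rw [rightSat, List.take_succ_eq_append_getElem hj, List.any_append]
      simp [rightSat]
    simp only [hL, hR]
    simp only [litBody, block, incr, decr, move, wp, BinOp.eval, List.getD_cons_succ,
      List.getD_cons_zero, List.set_cons_succ, List.set_cons_zero, List.length_cons,
      List.length_nil, hc j hj, litCode_and_one, litCode_shiftRight_one, shiftRight_and_one,
      Bool.toNat_eq_toNat, true_and]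
    generalize cl[j].1.val = v at *
    generalize cl[j].2 = b at *
    have h1 (x : ℕ) := (i.testBit x).toNat_le
    have hs1 := hs v
    have hs2 := hs (v - h)
    have h11 := h1 v
    have h12 := h1 (v - h)
    have hw0 : w ≠ 0 := by rintro rfl; omega
    clear hs h1
    by_cases hvh : v < h
    · by_cases hvb : i.testBit v = b
      · simp [hvh, hvb, hw0]
        omega
      · simp [hvh, beq_false_of_ne hvb, hvb, hw0]
        omega
    · by_cases hvb : i.testBit (v - h) = b
      · simp [hvh, hvb, hw0]
        omega
      · simp [hvh, beq_false_of_ne hvb, hvb]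
        omega
  · exact ⟨rfl, z₁₄, z₁₅, z₁₆, by simp [leftSat, rightSat]⟩
  · rintro l m ⟨rfl, x₁₄, x₁₅, x₁₆, rfl⟩
    exact ⟨rfl, x₁₄, x₁₅, x₁₆, by simp⟩

/-- The words for a clause. -/
def clauseWords {n : ℕ} (cl : List (Fin n × Bool)) : List ℕ := cl.length :: cl.map litCode

theorem encode_cnf (x : CNFInput) :
    x.encode = x.n :: x.m :: x.clauses.flatMap clauseWords := rfl

/-- The literals of a clause are distinct. This is what bounds the input length, and hence the
running time, in terms of `n` and `m`. -/
theorem clause_length_le {x : CNFInput} {cl : List (Fin x.n × Bool)} (h : cl ∈ x.clauses) :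
    cl.length ≤ 2 * x.n := by
  have := (x.nodup cl h).length_le_card
  simp at this
  omega

theorem encode_cnf_length_le (x : CNFInput) : x.encode.length ≤ (2 * x.n + 1) * x.m + 2 := by
  have h : ∀ L : List (List (Fin x.n × Bool)), (∀ cl ∈ L, cl.length ≤ 2 * x.n) →
      (L.flatMap clauseWords).length ≤ (2 * x.n + 1) * L.length := by
    intro L
    induction L with
    | nil => simp
    | cons cl L ih =>
      intro hL
      have h1 := hL cl (by simp)
      have h2 := ih fun cl hcl => hL cl (by simp [hcl])
      simp only [List.flatMap_cons, List.length_append, List.length_cons, clauseWords,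
        List.length_map, mul_add, mul_one] at h2 ⊢
      omega
  have := h x.clauses fun cl hcl => clause_length_le hcl
  rw [encode_cnf, List.length_cons, List.length_cons, CNFInput.m]
  omega

theorem _root_.List.getD_add_of_drop_eq {l l' : List ℕ} {k : ℕ} (h : l.drop k = l') (j : ℕ) :
    l.getD (k + j) 0 = l'.getD j 0 := by
  subst h
  simp [List.getD_eq_getElem?_getD]

/-- Whether clause `c` is left unsatisfied by assignment `i` of the first half. -/
def leftUnsat (x : CNFInput) (h i c : ℕ) : Bool := !leftSat h i (x.clauses.getD c [])

/-- Whether clause `c` is left unsatisfied by assignment `i` of the second half. -/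
def rightUnsat (x : CNFInput) (h i c : ℕ) : Bool := !rightSat h i (x.clauses.getD c [])

/-! ### The table of unsatisfied clauses -/

section

variable {x : CNFInput} {w N tb h : ℕ}

theorem ex_clauses (htb : x.encode.length ≤ tb) {r i z₄ z₁₁ z₁₂ z₁₃ z₁₄ z₁₅ z₁₆ : ℕ} {out : List ℕ}
    (hw : tb + out.length + 2 * x.m < 2 ^ w) (hi : i < 2 ^ w) (hn : 2 * x.n + 2 < 2 ^ w) :
    Ex w (.loop 10 clauseBody)
      [0, N, x.m, tb, z₄, 1, tb + out.length, r, i, 2, x.m, z₁₁, z₁₂, z₁₃, z₁₄, z₁₅, z₁₆, h]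
      (lay (fun a => x.encode.getD a 0) tb out)
      (x.m * (5 + (2 * x.n * (20 + 1) + 1 + 6) + 1) + 1) fun l m =>
      ∃ out' x₉ x₁₁ x₁₂ x₁₃ x₁₄ x₁₅ x₁₆,
        out' = out ++ tableRow (leftUnsat x h) (rightUnsat x h) x.m i ∧
        l = [0, N, x.m, tb, z₄, 1, tb + out'.length, r, i, x₉, 0, x₁₁, x₁₂, x₁₃, x₁₄, x₁₅, x₁₆, h] ∧
        m = lay (fun a => x.encode.getD a 0) tb out' := by
  -- Clauses have varying lengths, so the read position is described through the unread suffix of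
  -- the input: it encodes the remaining clauses.
  refine (Ex.for x.m _ (fun c l m => ∃ out' x₉ x₁₁ x₁₂ x₁₃ x₁₄ x₁₅ x₁₆,
        out' = out ++ tableRow (leftUnsat x h) (rightUnsat x h) c i ∧
        x.encode.drop x₉ = (x.clauses.drop c).flatMap clauseWords ∧
        l = [0, N, x.m, tb, z₄, 1, tb + out'.length, r, i, x₉, x.m - c,
          x₁₁, x₁₂, x₁₃, x₁₄, x₁₅, x₁₆, h] ∧
        m = lay (fun a => x.encode.getD a 0) tb out') ?_ ?_ ?_).mono le_rfl ?_
  · rintro c l m ⟨out', x₉, x₁₁, x₁₂, x₁₃, x₁₄, x₁₅, x₁₆, -, -, rfl, rfl⟩; rfl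
  · rintro c l m hc ⟨out', x₉, x₁₁, x₁₂, x₁₃, x₁₄, x₁₅, x₁₆, hout, hdrop, rfl, rfl⟩
    have hout' : out'.length = out.length + c * 2 := by
      rw [hout, List.length_append, tableRow_length]
    obtain ⟨cl, hcl⟩ : ∃ cl, cl = x.clauses[c]'hc := ⟨_, rfl⟩
    have hcn := clause_length_le (hcl ▸ List.getElem_mem hc)
    rw [List.drop_eq_getElem_cons hc, ← hcl, List.flatMap_cons] at hdrop
    have hlen := congrArg List.length hdrop
    simp only [List.length_drop, List.length_append, clauseWords, List.length_cons,
      List.length_map] at hlen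
    have h0 : lay (fun a => x.encode.getD a 0) tb out' x₉ = cl.length := by
      rw [lay_of_lt (by omega)]
      exact List.getD_add_of_drop_eq hdrop 0
    have hj : ∀ j (hj : j < cl.length),
        lay (fun a => x.encode.getD a 0) tb out' (x₉ + 1 + j) = litCode cl[j] := by
      intro j hj
      rw [lay_of_lt (by omega), add_assoc, add_comm 1 j]
      rw [List.getD_add_of_drop_eq hdrop]
      simp only [clauseWords, List.cons_append, List.getD_cons_succ]
      rw [List.getD_append _ _ _ _ (by simpa using hj),
        List.getD_eq_getElem _ _ (by simpa using hj),
        List.getElem_map]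
    have hU : leftUnsat x h i c = !leftSat h i cl := by
      rw [leftUnsat, hcl, List.getD_eq_getElem _ _ hc]
    have hV : rightUnsat x h i c = !rightSat h i cl := by
      rw [rightUnsat, hcl, List.getD_eq_getElem _ _ hc]
    refine Ex.seq (R := fun l m => l = [0, N, x.m, tb, z₄, 1, tb + out'.length, r, i, x₉ + 1,
      x.m - c, cl.length, 1, 1, x₁₄, x₁₅, x₁₆, h] ∧
      m = lay (fun a => x.encode.getD a 0) tb out') ?_ ?_
    · refine Ex.of_wp ?_
      simp only [block, incr, move, wp, BinOp.eval, List.getD_cons_succ, List.getD_cons_zero,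
        List.set_cons_succ, List.set_cons_zero, List.length_cons, List.length_nil, h0]
      and_intros
      any_goals omega
      all_goals trivial
    rintro l m ⟨rfl, rfl⟩
    -- Every clause is charged for `2 * n` literals, so that all iterations share one time bound.
    refine Ex.seq (T := 2 * x.n * (20 + 1) + 1)
      ((ex_literals hj (by omega) hi hn).mono (by gcongr) fun _ _ h => h) ?_
    rintro l m ⟨rfl, y₁₄, y₁₅, y₁₆, rfl⟩
    refine (Ex.of_wp ?_).mono (T := 6) (by decide) fun _ _ h => h
    simp only [block, push, incr, decr, wp, BinOp.eval, List.getD_cons_succ, List.getD_cons_zero,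
      List.set_cons_succ, List.set_cons_zero, List.length_cons, List.length_nil,
      update_lay_two rfl]
    and_intros
    any_goals omega
    refine ⟨_, x₉ + 1 + cl.length, 0, (!leftSat h i cl).toNat, (!rightSat h i cl).toNat,
      y₁₄, y₁₅, y₁₆, ?_, ?_, ?_, rfl⟩
    · rw [tableRow_succ, ← List.append_assoc, ← hout, hU, hV]
    · rw [add_assoc, ← List.drop_drop, hdrop, clauseWords]
      simp [add_comm]
    · simp only [List.cons.injEq, List.length_append, List.length_cons, List.length_nil,
        true_and, and_true]
      omega
  · exact ⟨out, 2, z₁₁, z₁₂, z₁₃, z₁₄, z₁₅, z₁₆, by simp [tableRow], by simp [encode_cnf], by simp,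
      rfl⟩
  · rintro l m ⟨out', x₉, x₁₁, x₁₂, x₁₃, x₁₄, x₁₅, x₁₆, hout, -, rfl, rfl⟩
    exact ⟨out', x₉, x₁₁, x₁₂, x₁₃, x₁₄, x₁₅, x₁₆, hout, by simp, rfl⟩

theorem ex_assignments (htb : x.encode.length ≤ tb)
    {z₄ z₉ z₁₀ z₁₁ z₁₂ z₁₃ z₁₄ z₁₅ z₁₆ : ℕ}
    (hw : tb + 2 * (N * x.m) + N + x.m < 2 ^ w) (hn : 2 * x.n + 2 < 2 ^ w) :
    Ex w (.loop 7 assignmentBody)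
      [0, N, x.m, tb, z₄, 1, tb, N, 0, z₉, z₁₀, z₁₁, z₁₂, z₁₃, z₁₄, z₁₅, z₁₆, h]
      (lay (fun a => x.encode.getD a 0) tb [])
      (N * (3 + (x.m * (5 + (2 * x.n * (20 + 1) + 1 + 6) + 1) + 1 + 3) + 1) + 1) fun l m =>
        l.length = 18 ∧ l.getD 1 0 = N ∧ l.getD 2 0 = x.m ∧ l.getD 3 0 = tb ∧
        m = lay (fun a => x.encode.getD a 0) tb
          ((List.range N).flatMap (tableRow (leftUnsat x h) (rightUnsat x h) x.m)) := by
  refine (Ex.for N _ (fun i l m => ∃ out x₉ x₁₀ x₁₁ x₁₂ x₁₃ x₁₄ x₁₅ x₁₆,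
        out = (List.range i).flatMap (tableRow (leftUnsat x h) (rightUnsat x h) x.m) ∧
        l = [0, N, x.m, tb, z₄, 1, tb + out.length, N - i, i, x₉, x₁₀,
          x₁₁, x₁₂, x₁₃, x₁₄, x₁₅, x₁₆, h] ∧
        m = lay (fun a => x.encode.getD a 0) tb out) ?_ ?_ ?_).mono le_rfl ?_
  · rintro c l m ⟨out, x₉, x₁₀, x₁₁, x₁₂, x₁₃, x₁₄, x₁₅, x₁₆, -, rfl, rfl⟩; rfl
  · rintro i l m hi ⟨out, x₉, x₁₀, x₁₁, x₁₂, x₁₃, x₁₄, x₁₅, x₁₆, hout, rfl, rfl⟩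
    have h1 : out.length = 2 * (i * x.m) := by
      rw [hout, List.length_flatMap_range (tableRow_length _ _ _)]; ring
    have h2 : (i + 1) * x.m ≤ N * x.m := Nat.mul_le_mul_right _ hi
    rw [add_mul, one_mul] at h2
    refine Ex.seq (R := fun l m => l = [0, N, x.m, tb, z₄, 1, tb + out.length, N - i, i, 2, x.m,
      x₁₁, x₁₂, x₁₃, x₁₄, x₁₅, x₁₆, h] ∧ m = lay (fun a => x.encode.getD a 0) tb out) ?_ ?_
    · refine Ex.of_wp ?_
      simp only [block, move, wp, BinOp.eval, List.getD_cons_succ, List.getD_cons_zero,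
        List.set_cons_succ, List.set_cons_zero, List.length_cons, List.length_nil]
      and_intros
      any_goals omega
      all_goals trivial
    rintro l m ⟨rfl, rfl⟩
    refine Ex.seq (ex_clauses htb (by omega) (by omega) hn) ?_
    rintro l m ⟨out', x₉, x₁₁, x₁₂, x₁₃, x₁₄, x₁₅, x₁₆, hout', rfl, rfl⟩
    refine (Ex.of_wp ?_).mono (T := 3) (by decide) fun _ _ h => h
    simp only [block, incr, decr, wp, BinOp.eval, List.getD_cons_succ, List.getD_cons_zero,
      List.set_cons_succ, List.set_cons_zero, List.length_cons, List.length_nil]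
    and_intros
    any_goals omega
    refine ⟨out', x₉, 0, x₁₁, x₁₂, x₁₃, x₁₄, x₁₅, x₁₆, ?_, ?_, rfl⟩
    · rw [hout', hout, List.range_succ, List.flatMap_append, List.flatMap_singleton]
    · simp only [List.cons.injEq, true_and, and_true]
      omega
  · exact ⟨[], z₉, z₁₀, z₁₁, z₁₂, z₁₃, z₁₄, z₁₅, z₁₆, by simp, by simp, rfl⟩
  · rintro l m ⟨out, x₉, x₁₀, x₁₁, x₁₂, x₁₃, x₁₄, x₁₅, x₁₆, rfl, rfl, rfl⟩
    exact ⟨rfl, rfl, rfl, rfl, rfl⟩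

theorem init_eq_st (y : List ℕ) : init y = st (List.replicate 18 0) fun a => y.getD a 0 := by
  simp only [init, st, State.mk.injEq, and_true]
  funext i
  rcases lt_or_ge i 18 with h | h
  · interval_cases i <;> rfl
  · rw [List.getD_eq_default]
    simpa using h

theorem ex_satTable (htb : tb = (2 * x.n + 1) * x.m + 2) (hN : N = 2 ^ ((x.n + 1) / 2))
    (hw : tb + 2 * (N * x.m) + N + 2 * x.m + 2 * x.n + 2 < 2 ^ w) :
    Ex w satTable (List.replicate 18 0) (fun a => x.encode.getD a 0)
      (18 + N * (x.m * (42 * x.n + 13) + 8)) fun l m =>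
        l.length = 18 ∧ l.getD 1 0 = N ∧ l.getD 2 0 = x.m ∧ l.getD 3 0 = tb ∧
        m = lay (fun a => x.encode.getD a 0) tb ((List.range N).flatMap
          (tableRow (leftUnsat x ((x.n + 1) / 2)) (rightUnsat x ((x.n + 1) / 2)) x.m)) := by
  refine Ex.mono (T := 17 + (N * (3 + (x.m * (5 + (2 * x.n * (20 + 1) + 1 + 6) + 1) + 1 + 3) + 1)
    + 1)) (Ex.seq (R := fun l m =>
    l = [0, N, x.m, tb, x.n, 1, tb, N, 0, 0, 0, 0, 0, 0, 0, 0, 0, (x.n + 1) / 2] ∧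
      m = lay (fun a => x.encode.getD a 0) tb []) ?_ fun l m hlm => ?_) ?_ fun _ _ h => h
  · refine (Ex.of_wp ?_).mono (T := cost satHeader) (by decide) fun _ _ h => h
    have h0 : x.encode.getD 0 0 = x.n := rfl
    have h1 : x.encode.getD 1 0 = x.m := rfl
    have hN' : 1 <<< ((x.n + 1) / 2) = N := by rw [hN, Nat.one_shiftLeft]
    have htb' : (2 * x.n + 1) * x.m = tb - 2 := by omega
    have hnn : (x.n + x.n + 1) * x.m = tb - 2 := by rw [← htb']; ring
    simp only [satHeader, block, incr, move, wp, BinOp.eval, List.replicate, List.getD_cons_succ,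
      List.getD_cons_zero, List.set_cons_succ, List.set_cons_zero, List.length_cons,
      List.length_nil, h0, h1, Nat.shiftRight_one, hN', hnn]
    rw [← lay_nil (by rw [htb]; exact encode_cnf_length_le x)]
    and_intros
    any_goals omega
    · simp only [List.cons.injEq, true_and, and_true]
      omega
    · rfl
  · obtain ⟨rfl, rfl⟩ := hlm
    exact ex_assignments (by rw [htb]; exact encode_cnf_length_le x) (by omega) (by omega)
  · ring_nf
    omega

end

end WordRAM

namespace WordRAM

/-! ### Dominating sets: the adjacency matrix -/

/-- `mat` is the 0-1 matrix of the relation `R` on `{0, …, n - 1}`. -/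
structure IsMatrix (n : ℕ) (R : ℕ → ℕ → Prop) (mat : List ℕ) : Prop where
  length : mat.length = n * n
  le_one : ∀ i, mat.getD i 0 ≤ 1
  entry : ∀ u < n, ∀ v < n, (mat.getD (u * n + v) 0 ≠ 0 ↔ R u v)

theorem matrix_index_lt {n u v : ℕ} (hu : u < n) (hv : v < n) : u * n + v < n * n := by
  have : (u + 1) * n ≤ n * n := Nat.mul_le_mul_right n hu
  rw [add_mul, one_mul] at this
  omega

theorem matrix_index_inj {n u v a b : ℕ} (hv : v < n) (hb : b < n) :
    u * n + v = a * n + b ↔ u = a ∧ v = b := by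
  constructor
  · intro h
    have h1 := congrArg (· / n) h
    have h2 := congrArg (· % n) h
    simp only [Nat.mul_add_mod_self_right, Nat.mod_eq_of_lt hv, Nat.mod_eq_of_lt hb] at h2
    have hn : 0 < n := by omega
    simp only [Nat.mul_comm _ n, Nat.mul_add_div hn, Nat.div_eq_of_lt hv,
      Nat.div_eq_of_lt hb] at h1
    omega
  · rintro ⟨rfl, rfl⟩; rfl

theorem IsMatrix.set {n : ℕ} {R : ℕ → ℕ → Prop} {mat : List ℕ} (h : IsMatrix n R mat) {a b : ℕ}
    (ha : a < n) (hb : b < n) :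
    IsMatrix n (fun u v => R u v ∨ (u = a ∧ v = b)) (mat.set (a * n + b) 1) where
  length := by simpa using h.length
  le_one i := by
    have := h.le_one i
    simp only [List.getD_eq_getElem?_getD, List.getElem?_set] at this ⊢
    split
    · split <;> simp
    · exact this
  entry u hu v hv := by
    rw [← matrix_index_inj hv hb, ← h.entry u hu v hv]
    have hlt := matrix_index_lt ha hb
    rw [← h.length] at hlt
    simp only [List.getD_eq_getElem?_getD, List.getElem?_set]
    by_cases he : u * n + v = a * n + b
    · simp [he, hlt]
    · simp [he, Ne.symm he]

theorem IsMatrix.congr {n : ℕ} {R R' : ℕ → ℕ → Prop} {mat : List ℕ} (h : IsMatrix n R mat)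
    (hR : ∀ u < n, ∀ v < n, (R u v ↔ R' u v)) : IsMatrix n R' mat :=
  ⟨h.length, h.le_one, fun u hu v hv => (h.entry u hu v hv).trans (hR u hu v hv)⟩

theorem isMatrix_replicate (n : ℕ) : IsMatrix n (fun _ _ => False) (List.replicate (n * n) 0) where
  length := by simp
  le_one i := by
    simp only [List.getD_eq_getElem?_getD, List.getElem?_replicate]
    split <;> simp
  entry u hu v hv := by
    simp only [List.getD_eq_getElem?_getD, List.getElem?_replicate]
    split <;> simp

/-- Blank memory already represents the zero matrix, so nothing has to be cleared. -/
theorem lay_replicate (low : ℕ → ℕ) (base k : ℕ) :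
    lay low base [] = lay low base (List.replicate k 0) := by
  funext a
  simp only [lay]
  split
  · rfl
  · simp only [List.getD_eq_getElem?_getD, List.getElem?_replicate]
    split <;> simp

def diagBody : Prog := block [.store 14 5, .op .add 14 14 16, decr 10]

def edgeBody : Prog := block
  [.load 13 16, incr 16, .load 14 16, incr 16,
    .op .mul 15 13 4, .op .add 15 15 14, .op .add 15 15 9, .store 15 5,
    .op .mul 15 14 4, .op .add 15 15 13, .op .add 15 15 9, .store 15 5, decr 17]

section

variable {w n N D tb B : ℕ} {low : ℕ → ℕ}

theorem ex_diag {z₆ z₇ z₈ z₁₁ z₁₂ z₁₃ z₁₅ z₁₇ : ℕ} (hw : B + n * n + n + 1 < 2 ^ w) :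
    Ex w (.loop 10 diagBody)
      [0, N, D, tb, n, 1, z₆, z₇, z₈, B, n, z₁₁, z₁₂, z₁₃, B, z₁₅, n + 1, z₁₇]
      (lay low B []) (n * (4 + 1) + 1) fun l m => ∃ mat x₁₄, IsMatrix n (fun u v => u = v) mat ∧
      l = [0, N, D, tb, n, 1, z₆, z₇, z₈, B, 0, z₁₁, z₁₂, z₁₃, x₁₄, z₁₅, n + 1, z₁₇] ∧
      m = lay low B mat := by
  refine (Ex.for n 4 (fun j l m => ∃ mat, IsMatrix n (fun u v => u = v ∧ u < j) mat ∧
      l = [0, N, D, tb, n, 1, z₆, z₇, z₈, B, n - j, z₁₁, z₁₂, z₁₃, B + (j * n + j), z₁₅, n + 1, z₁₇]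
      ∧ m = lay low B mat) ?_ ?_ ?_).mono le_rfl ?_
  · rintro j l m ⟨mat, -, rfl, rfl⟩; rfl
  · rintro j l m hj ⟨mat, hmat, rfl, rfl⟩
    refine (Ex.of_wp ?_).mono (T := cost diagBody) (by decide) fun _ _ h => h
    have h1 := matrix_index_lt hj hj
    rw [diagBody]
    simp only [block, decr, wp, BinOp.eval, List.getD_cons_succ, List.getD_cons_zero,
      List.set_cons_succ, List.set_cons_zero, List.length_cons, List.length_nil]
    rw [update_lay_set (by rw [hmat.length]; exact h1)]
    and_intros
    any_goals omega
    refine ⟨_, (hmat.set hj hj).congr fun u _ v _ => by omega, ?_, rfl⟩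
    simp only [List.cons.injEq, true_and, and_true, add_mul]
    omega
  · refine ⟨_, (isMatrix_replicate n).congr fun u _ v _ => by simp, by simp, ?_⟩
    exact lay_replicate low B (n * n)
  · rintro l m ⟨mat, hmat, rfl, rfl⟩
    exact ⟨mat, _, hmat.congr fun u hu v _ => by omega, by simp; rfl, rfl⟩

end

theorem encode_graph (x : GraphInput) :
    x.encode = x.n :: x.m :: x.edges.flatMap fun e => [(e.1 : ℕ), (e.2 : ℕ)] := rfl

theorem ex_edges {x : GraphInput} {w N D tb z₆ z₇ z₈ z₁₀ z₁₁ z₁₂ z₁₃ z₁₄ z₁₅ B : ℕ} {mat : List ℕ}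
    (hB : B = 2 + 2 * x.m) (hmat : IsMatrix x.n (fun u v => u = v) mat)
    (hw : B + x.n * x.n + x.n + 1 < 2 ^ w) :
    Ex w (.loop 17 edgeBody)
      [0, N, D, tb, x.n, 1, z₆, z₇, z₈, B, z₁₀, z₁₁, z₁₂, z₁₃, z₁₄, z₁₅, 2, x.m]
      (lay (fun a => x.encode.getD a 0) B mat) (x.m * (14 + 1) + 1) fun l m =>
      ∃ mat x₁₃ x₁₄ x₁₅ x₁₆, IsMatrix x.n
        (fun u v => u = v ∨ ∃ e ∈ x.edges, (u = e.1 ∧ v = e.2) ∨ (u = e.2 ∧ v = e.1)) mat ∧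
      l = [0, N, D, tb, x.n, 1, z₆, z₇, z₈, B, z₁₀, z₁₁, z₁₂, x₁₃, x₁₄, x₁₅, x₁₆, 0] ∧
      m = lay (fun a => x.encode.getD a 0) B mat := by
  refine (Ex.for x.m 14 (fun j l m => ∃ mat x₁₃ x₁₄ x₁₅ x₁₆, IsMatrix x.n
        (fun u v => u = v ∨ ∃ e ∈ x.edges.take j, (u = e.1 ∧ v = e.2) ∨ (u = e.2 ∧ v = e.1)) mat ∧
      x.encode.drop x₁₆ = (x.edges.drop j).flatMap (fun e => [(e.1 : ℕ), (e.2 : ℕ)]) ∧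
      l = [0, N, D, tb, x.n, 1, z₆, z₇, z₈, B, z₁₀, z₁₁, z₁₂, x₁₃, x₁₄, x₁₅, x₁₆, x.m - j] ∧
      m = lay (fun a => x.encode.getD a 0) B mat) ?_ ?_ ?_).mono le_rfl ?_
  · rintro j l m ⟨mat, x₁₃, x₁₄, x₁₅, x₁₆, -, -, rfl, rfl⟩; rfl
  · rintro j l m hj ⟨mat, x₁₃, x₁₄, x₁₅, x₁₆, hmat, hdrop, rfl, rfl⟩
    obtain ⟨e, he⟩ : ∃ e, e = x.edges[j]'hj := ⟨_, rfl⟩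
    rw [List.drop_eq_getElem_cons hj, ← he, List.flatMap_cons] at hdrop
    have hlen := congrArg List.length hdrop
    simp only [List.length_drop, List.length_append, List.length_cons, List.length_nil,
      x.encode_length] at hlen
    have h0 : lay (fun a => x.encode.getD a 0) B mat x₁₆ = e.1 := by
      rw [lay_of_lt (by omega)]
      exact List.getD_add_of_drop_eq hdrop 0
    have h1 : lay (fun a => x.encode.getD a 0) B mat (x₁₆ + 1) = e.2 := by
      rw [lay_of_lt (by omega)]
      exact List.getD_add_of_drop_eq hdrop 1
    have hu := e.1.2
    have hv := e.2.2
    have huv := matrix_index_lt hu hv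
    have hvu := matrix_index_lt hv hu
    have hm1 := hmat.set hu hv
    have hm2 := hm1.set hv hu
    have hset1 : Function.update (lay (fun a => x.encode.getD a 0) B mat) (e.1 * x.n + e.2 + B) 1 =
        lay (fun a => x.encode.getD a 0) B (mat.set (e.1 * x.n + e.2) 1) := by
      rw [add_comm (_ * _ + _) B, update_lay_set (by rw [hmat.length]; exact huv)]
    have hset2 : Function.update (lay (fun a => x.encode.getD a 0) B
          (mat.set (e.1 * x.n + e.2) 1)) (e.2 * x.n + e.1 + B) 1 =
        lay (fun a => x.encode.getD a 0) B
          ((mat.set (e.1 * x.n + e.2) 1).set (e.2 * x.n + e.1) 1) := by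
      rw [add_comm (_ * _ + _) B, update_lay_set (by rw [hm1.length]; exact hvu)]
    refine (Ex.of_wp ?_).mono (T := cost edgeBody) (by decide) fun _ _ h => h
    simp only [edgeBody, block, incr, decr, wp, BinOp.eval, List.getD_cons_succ,
      List.getD_cons_zero, List.set_cons_succ, List.set_cons_zero, List.length_cons,
      List.length_nil, h0, h1, hset1, hset2]
    and_intros
    any_goals omega
    refine ⟨_, e.1, e.2, e.2 * x.n + e.1 + B, x₁₆ + 1 + 1, hm2.congr fun u _ v _ => ?_, ?_, ?_, rfl⟩
    · rw [List.take_succ_eq_append_getElem hj, ← he]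
      simp only [List.mem_append, List.mem_singleton, or_and_right, exists_or, exists_eq_left,
        or_assoc]
    · rw [add_assoc, ← List.drop_drop, hdrop]
      rfl
    · simp only [List.cons.injEq, true_and, and_true]
      omega
  · exact ⟨mat, z₁₃, z₁₄, z₁₅, 2, hmat.congr fun u _ v _ => by simp, by simp [encode_graph],
      by simp, rfl⟩
  · rintro l m ⟨mat, x₁₃, x₁₄, x₁₅, x₁₆, hmat, -, rfl, rfl⟩
    exact ⟨mat, x₁₃, x₁₄, x₁₅, x₁₆, hmat.congr fun u _ v _ => by simp [GraphInput.m], by simp, rfl⟩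

/-! ### Dominating sets: the table -/

/-- The last `k` digits of `i` in base `n`. -/
def digitList (n : ℕ) : ℕ → ℕ → List ℕ
  | 0, _ => []
  | k + 1, i => i % n :: digitList n k (i / n)

/-- Multiply register 1 by the `k`-th power of register 4. -/
def powProg : ℕ → Prog
  | 0 => .skip
  | k + 1 => .seq (.op .mul 1 1 4) (powProg k)

/-- Test whether one of `k` vertices dominates the vertex in register 11. -/
def scanProg : ℕ → Prog
  | 0 => .skip
  | k + 1 => .seq (block [.op .mod 14 13 4, .op .div 13 13 4, .op .mul 14 14 4, .op .add 14 14 11,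
      .op .add 14 14 9, .load 15 14, .branch 15 (move 12 0) .skip]) (scanProg k)

/-- As `n` is positive, the intermediate products are at most the final one, so only the result has
to be known to fit into a word. -/
theorem ex_powProg {w n : ℕ} (hn : 0 < n) {z₀ z₂ z₃ : ℕ} {l : List ℕ} {m : ℕ → ℕ} (k : ℕ) :
    ∀ a, a * n ^ k < 2 ^ w → Ex w (powProg k) (z₀ :: a :: z₂ :: z₃ :: n :: l) m (k + 1)
      fun l' m' => l' = z₀ :: a * n ^ k :: z₂ :: z₃ :: n :: l ∧ m' = m := by
  induction k with
  | zero => exact fun a ha => Ex.of_wp ⟨by simp, rfl⟩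
  | succ k ih =>
    intro a ha
    have h1 : a * n * n ^ k = a * n ^ (k + 1) := by ring
    have h2 : a * n ≤ a * n ^ (k + 1) := by
      rw [← h1]; exact Nat.le_mul_of_pos_right _ (by positivity)
    refine (Ex.seq (T := 1) (T' := k + 1) (R := fun l' m' =>
      l' = z₀ :: a * n :: z₂ :: z₃ :: n :: l ∧ m' = m) (Ex.of_wp ?_) ?_).mono
      (by omega) fun _ _ h => h
    · refine ⟨?_, by simp, rfl, rfl⟩
      simp only [BinOp.eval, List.getD_cons_succ, List.getD_cons_zero]
      omega
    · rintro l m ⟨rfl, rfl⟩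
      rw [← h1]
      exact ih (a * n) (by omega)

/-- The base-`n` digits of `y` are the members of a tuple, split off one by one; a nonzero matrix
entry in column `c` clears the flag. The code is unrolled, `k` being a constant of the algorithm. -/
theorem ex_scanProg {w n N D tb B p r k₁ c : ℕ} {low : ℕ → ℕ} {out mat : List ℕ}
    {R : ℕ → ℕ → Prop} [∀ u v, Decidable (R u v)]
    (htb : tb = B + n * n) (hmat : IsMatrix n R mat) (hn : 0 < n) (hc : c < n)
    (hw : tb < 2 ^ w) {i : ℕ} (k : ℕ) :
    ∀ y (b : Bool) z₁₄ z₁₅ z₁₆ z₁₇, y < 2 ^ w → Ex w (scanProg k)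
      [0, N, D, tb, n, 1, p, r, i, B, k₁, c, b.toNat, y, z₁₄, z₁₅, z₁₆, z₁₇]
      (lay (lay low B mat) tb out) (9 * k + 1) fun l m => m = lay (lay low B mat) tb out ∧
      ∃ x₁₃ x₁₄ x₁₅, l = [0, N, D, tb, n, 1, p, r, i, B, k₁, c,
        (b && !(digitList n k y).any fun d => R d c).toNat, x₁₃, x₁₄, x₁₅, z₁₆, z₁₇] := by
  induction k with
  | zero => exact fun y b z₁₄ z₁₅ z₁₆ z₁₇ hy => Ex.of_wp ⟨rfl, y, z₁₄, z₁₅, by simp [digitList]⟩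
  | succ k ih =>
    intro y b z₁₄ z₁₅ z₁₆ z₁₇ hy
    have hd : y % n < n := Nat.mod_lt _ hn
    have hlt := matrix_index_lt hd hc
    have hentry := hmat.entry _ hd _ hc
    have hle := hmat.le_one (y % n * n + c)
    have hload : lay (lay low B mat) tb out (y % n * n + c + B) = mat.getD (y % n * n + c) 0 := by
      rw [lay_of_lt (by omega), add_comm _ B, lay_add]
    have hdiv := Nat.div_le_self y n
    have hmod := Nat.mod_le y n
    have h2w : 1 < 2 ^ w := by nlinarith
    refine (Ex.seq (T := 9) (T' := 9 * k + 1) (R := fun l m =>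
      m = lay (lay low B mat) tb out ∧ ∃ x₁₄ x₁₅, l = [0, N, D, tb, n, 1, p, r, i, B, k₁, c,
        (b && !(R (y % n) c : Bool)).toNat, y / n, x₁₄, x₁₅, z₁₆, z₁₇]) ?_ ?_).mono
      (by omega) fun _ _ h => h
    · refine (Ex.of_wp ?_).mono (T := 9) (by decide) fun _ _ h => h
      simp only [block, move, wp, BinOp.eval, List.getD_cons_succ,
        List.getD_cons_zero, List.set_cons_succ, List.set_cons_zero, List.length_cons,
        List.length_nil, hload, hentry]
      and_intros
      any_goals omega
      · intro hR
        exact ⟨by omega, by omega, trivial, y % n * n + c + B,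
          mat.getD (y % n * n + c) 0, by simp [hR]⟩
      · intro h0
        have hR : ¬ R (y % n) c := fun hR => hentry.2 hR h0
        exact ⟨trivial, y % n * n + c + B, mat.getD (y % n * n + c) 0, by simp [hR]⟩
    · rintro l m ⟨rfl, x₁₄, x₁₅, rfl⟩
      refine (ih (y / n) _ x₁₄ x₁₅ z₁₆ z₁₇ (by omega)).mono le_rfl ?_
      rintro l m ⟨rfl, x₁₃, x₁₄, x₁₅, rfl⟩
      refine ⟨rfl, x₁₃, x₁₄, x₁₅, ?_⟩
      simp [digitList, Bool.and_assoc]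

def vertexBody (k : ℕ) : Prog :=
  .seq (block [move 13 8, move 12 5]) <|
  .seq (scanProg k) (block [push 12, push 12, incr 11, decr 10])

def tupleBody (k : ℕ) : Prog :=
  .seq (block [move 11 0, move 10 2]) <| .seq (.loop 10 (vertexBody k)) (block [incr 8, decr 7])

/-- Expects `n` in register 4 and 1 in register 5. The matrix is placed right behind the input, at
`2 + 2 * m`, and the table right behind the matrix. Register 16 receives `n + 1`, the distance
between consecutive diagonal entries. -/
def domHeader : Prog := block
  [.load 17 5, .op .add 9 17 17, incr 9, incr 9, .op .mul 3 4 4, .op .add 3 3 9, move 2 4,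
    move 6 3, .const 1 1, move 10 4, move 14 9, .op .add 16 4 5]

/-- Write the table of the vertices not dominated by the `k`-tuples of vertices. -/
def domTable (k : ℕ) : Prog :=
  .seq domHeader <| .seq (.loop 10 diagBody) <| .seq (.const 16 2) <| .seq (.loop 17 edgeBody) <|
  .seq (powProg k) <| .seq (move 7 1) (.loop 7 (tupleBody k))

/-- Whether vertex `c` is left undominated by the `k`-tuple with number `i`. -/
def undominated (n k : ℕ) (R : ℕ → ℕ → Prop) [∀ u v, Decidable (R u v)] (i c : ℕ) : Bool :=
  !(digitList n k i).any fun d => R d c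

/-! ### The table of undominated vertices -/

section

variable {w n N tb B k : ℕ} {low : ℕ → ℕ} {mat : List ℕ} {R : ℕ → ℕ → Prop}
  [∀ u v, Decidable (R u v)]

theorem ex_vertices (htb : tb = B + n * n) (hmat : IsMatrix n R mat) (hn : 0 < n)
    {i r z₁₂ z₁₃ z₁₄ z₁₅ z₁₆ z₁₇ : ℕ} {out : List ℕ}
    (hw : tb + out.length + 2 * n < 2 ^ w) (hi : i < 2 ^ w) :
    Ex w (.loop 10 (vertexBody k))
      [0, N, n, tb, n, 1, tb + out.length, r, i, B, n, 0, z₁₂, z₁₃, z₁₄, z₁₅, z₁₆, z₁₇]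
      (lay (lay low B mat) tb out) (n * (3 + (9 * k + 1 + 7) + 1) + 1) fun l m =>
      ∃ out' x₁₂ x₁₃ x₁₄ x₁₅, out' = out ++ tableRow (undominated n k R) (undominated n k R) n i ∧
        l = [0, N, n, tb, n, 1, tb + out'.length, r, i, B, 0, n, x₁₂, x₁₃, x₁₄, x₁₅, z₁₆, z₁₇] ∧
        m = lay (lay low B mat) tb out' := by
  refine (Ex.for n _ (fun c l m => ∃ out' x₁₂ x₁₃ x₁₄ x₁₅,
      out' = out ++ tableRow (undominated n k R) (undominated n k R) c i ∧
      l = [0, N, n, tb, n, 1, tb + out'.length, r, i, B, n - c, c, x₁₂, x₁₃, x₁₄, x₁₅, z₁₆, z₁₇] ∧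
      m = lay (lay low B mat) tb out') ?_ ?_ ?_).mono le_rfl ?_
  · rintro c l m ⟨out', x₁₂, x₁₃, x₁₄, x₁₅, -, rfl, rfl⟩; rfl
  · rintro c l m hc ⟨out', x₁₂, x₁₃, x₁₄, x₁₅, hout, rfl, rfl⟩
    have hout' : out'.length = out.length + c * 2 := by
      rw [hout, List.length_append, tableRow_length]
    refine Ex.seq (R := fun l m =>
      l = [0, N, n, tb, n, 1, tb + out'.length, r, i, B, n - c, c, (true).toNat, i, x₁₄, x₁₅,
        z₁₆, z₁₇] ∧ m = lay (lay low B mat) tb out') ?_ ?_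
    · refine Ex.of_wp ?_
      simp only [block, move, wp, BinOp.eval, List.getD_cons_succ, List.getD_cons_zero,
        List.set_cons_succ, List.set_cons_zero, List.length_cons, List.length_nil]
      and_intros
      any_goals omega
      all_goals trivial
    rintro l m ⟨rfl, rfl⟩
    refine Ex.seq (ex_scanProg htb hmat hn hc (by omega) k i true x₁₄ x₁₅ z₁₆ z₁₇ hi) ?_
    rintro l m ⟨rfl, x₁₃, x₁₄, x₁₅, rfl⟩
    have hU : (true && !(digitList n k i).any fun d => R d c) = undominated n k R i c := by
      rw [Bool.true_and, undominated]
    rw [hU]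
    refine (Ex.of_wp ?_).mono (T := 7) (by decide) fun _ _ h => h
    simp only [block, push, incr, decr, wp, BinOp.eval, List.getD_cons_succ, List.getD_cons_zero,
      List.set_cons_succ, List.set_cons_zero, List.length_cons, List.length_nil,
      update_lay_two rfl]
    and_intros
    any_goals omega
    refine ⟨_, (undominated n k R i c).toNat, x₁₃, x₁₄, x₁₅, ?_, ?_, rfl⟩
    · rw [tableRow_succ, ← List.append_assoc, ← hout]
    · simp only [List.cons.injEq, List.length_append, List.length_cons, List.length_nil,
        true_and, and_true]
      omega
  · exact ⟨out, z₁₂, z₁₃, z₁₄, z₁₅, by simp [tableRow], by simp, rfl⟩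
  · rintro l m ⟨out', x₁₂, x₁₃, x₁₄, x₁₅, hout, rfl, rfl⟩
    exact ⟨out', x₁₂, x₁₃, x₁₄, x₁₅, hout, by simp, rfl⟩

theorem ex_tuples (htb : tb = B + n * n) (hmat : IsMatrix n R mat) (hn : 0 < n)
    {z₁₀ z₁₁ z₁₂ z₁₃ z₁₄ z₁₅ z₁₆ z₁₇ : ℕ}
    (hw : tb + 2 * (N * n) + N + n < 2 ^ w) :
    Ex w (.loop 7 (tupleBody k))
      [0, N, n, tb, n, 1, tb, N, 0, B, z₁₀, z₁₁, z₁₂, z₁₃, z₁₄, z₁₅, z₁₆, z₁₇]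
      (lay (lay low B mat) tb []) (N * (3 + (n * (3 + (9 * k + 1 + 7) + 1) + 1 + 3) + 1) + 1)
      fun l m => l.length = 18 ∧ l.getD 1 0 = N ∧ l.getD 2 0 = n ∧ l.getD 3 0 = tb ∧
        m = lay (lay low B mat) tb
          ((List.range N).flatMap (tableRow (undominated n k R) (undominated n k R) n)) := by
  refine (Ex.for N _ (fun i l m => ∃ out x₁₀ x₁₁ x₁₂ x₁₃ x₁₄ x₁₅,
        out = (List.range i).flatMap (tableRow (undominated n k R) (undominated n k R) n) ∧
        l = [0, N, n, tb, n, 1, tb + out.length, N - i, i, B, x₁₀, x₁₁, x₁₂, x₁₃, x₁₄, x₁₅,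
          z₁₆, z₁₇] ∧
        m = lay (lay low B mat) tb out) ?_ ?_ ?_).mono le_rfl ?_
  · rintro c l m ⟨out, x₁₀, x₁₁, x₁₂, x₁₃, x₁₄, x₁₅, -, rfl, rfl⟩; rfl
  · rintro i l m hi ⟨out, x₁₀, x₁₁, x₁₂, x₁₃, x₁₄, x₁₅, hout, rfl, rfl⟩
    have h1 : out.length = 2 * (i * n) := by
      rw [hout, List.length_flatMap_range (tableRow_length _ _ _)]; ring
    have h2 : (i + 1) * n ≤ N * n := Nat.mul_le_mul_right _ hi
    rw [add_mul, one_mul] at h2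
    refine Ex.seq (R := fun l m => l = [0, N, n, tb, n, 1, tb + out.length, N - i, i, B, n, 0,
      x₁₂, x₁₃, x₁₄, x₁₅, z₁₆, z₁₇] ∧ m = lay (lay low B mat) tb out) ?_ ?_
    · refine Ex.of_wp ?_
      simp only [block, move, wp, BinOp.eval, List.getD_cons_succ, List.getD_cons_zero,
        List.set_cons_succ, List.set_cons_zero, List.length_cons, List.length_nil]
      and_intros
      any_goals omega
      all_goals trivial
    rintro l m ⟨rfl, rfl⟩
    refine Ex.seq (ex_vertices htb hmat hn (by omega) (by omega)) ?_
    rintro l m ⟨out', x₁₂, x₁₃, x₁₄, x₁₅, hout', rfl, rfl⟩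
    refine (Ex.of_wp ?_).mono (T := 3) (by decide) fun _ _ h => h
    simp only [block, incr, decr, wp, BinOp.eval, List.getD_cons_succ, List.getD_cons_zero,
      List.set_cons_succ, List.set_cons_zero, List.length_cons, List.length_nil]
    and_intros
    any_goals omega
    refine ⟨out', 0, n, x₁₂, x₁₃, x₁₄, x₁₅, ?_, ?_, rfl⟩
    · rw [hout', hout, List.range_succ, List.flatMap_append, List.flatMap_singleton]
    · simp only [List.cons.injEq, true_and, and_true]
      omega
  · exact ⟨[], z₁₀, z₁₁, z₁₂, z₁₃, z₁₄, z₁₅, by simp, by simp, rfl⟩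
  · rintro l m ⟨out, x₁₀, x₁₁, x₁₂, x₁₃, x₁₄, x₁₅, rfl, rfl, rfl⟩
    exact ⟨rfl, rfl, rfl, rfl, rfl⟩

end

/-- Adjacency or equality, for vertices given as numbers. -/
def _root_.GraphInput.Dominates (x : GraphInput) (u v : ℕ) : Prop :=
  u = v ∨ ∃ e ∈ x.edges, (u = e.1 ∧ v = e.2) ∨ (u = e.2 ∧ v = e.1)

open Classical in
theorem ex_domTable {x : GraphInput} {w N tb k z₁₅ : ℕ} (htb : tb = 2 + 2 * x.m + x.n * x.n)
    (hN : N = x.n ^ k) (hn : 0 < x.n)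
    (hw : tb + 2 * (N * x.n) + N + x.n + 2 < 2 ^ w) :
    Ex w (domTable k) [0, 0, 0, 0, x.n, 1, 0, 0, 0, 0, 0, 0, 0, 0, 0, z₁₅, 0, 0]
      (fun a => x.encode.getD a 0)
      (20 + x.n * 5 + x.m * 15 + k + N * (x.n * (9 * k + 12) + 8)) fun l m =>
      l.length = 18 ∧ l.getD 1 0 = N ∧ l.getD 2 0 = x.n ∧ l.getD 3 0 = tb ∧
        ∃ low, m = lay low tb ((List.range N).flatMap
          (tableRow (undominated x.n k x.Dominates)
            (undominated x.n k x.Dominates) x.n)) := by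
  obtain ⟨B, hB⟩ : ∃ B, B = 2 + 2 * x.m := ⟨_, rfl⟩
  rw [← hB] at htb
  refine Ex.mono (T := 13 + ((x.n * (4 + 1) + 1) + (1 + ((x.m * (14 + 1) + 1) + ((k + 1) + (1 +
    (N * (3 + (x.n * (3 + (9 * k + 1 + 7) + 1) + 1 + 3) + 1) + 1))))))) ?_ ?_ fun _ _ h => h
  · refine Ex.seq (R := fun l m => l = [0, 1, x.n, tb, x.n, 1, tb, 0, 0, B, x.n, 0, 0, 0, B, z₁₅,
      x.n + 1, x.m] ∧ m = lay (fun a => x.encode.getD a 0) B []) ?_ ?_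
    · refine (Ex.of_wp ?_).mono (T := cost domHeader) (by decide) fun _ _ h => h
      have h1 : x.encode.getD 1 0 = x.m := rfl
      simp only [domHeader, block, incr, move, wp, BinOp.eval, List.getD_cons_succ,
        List.getD_cons_zero, List.set_cons_succ, List.set_cons_zero, List.length_cons,
        List.length_nil, h1]
      rw [← lay_nil (by rw [x.encode_length]; omega)]
      and_intros
      any_goals omega
      · simp only [List.cons.injEq, true_and, and_true]
        omega
      · rfl
    rintro l m ⟨rfl, rfl⟩
    refine Ex.seq (ex_diag (by omega)) ?_
    rintro l m ⟨mat, x₁₄, hmat, rfl, rfl⟩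
    refine Ex.seq (R := fun l m => l = [0, 1, x.n, tb, x.n, 1, tb, 0, 0, B, 0, 0, 0, 0, x₁₄, z₁₅,
      2, x.m] ∧ m = lay (fun a => x.encode.getD a 0) B mat)
      (Ex.of_wp (p := .const 16 2) ⟨by omega, by simp, rfl, rfl⟩) ?_
    rintro l m ⟨rfl, rfl⟩
    refine Ex.seq (ex_edges hB hmat (by omega)) ?_
    rintro l m ⟨mat, x₁₃, x₁₄, x₁₅, x₁₆, hmat, rfl, rfl⟩
    refine Ex.seq (ex_powProg hn k 1 (by omega)) ?_
    rintro l m ⟨rfl, rfl⟩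
    rw [one_mul, ← hN, lay_nil_lay (base' := tb) (by rw [hmat.length, htb])]
    refine Ex.seq (R := fun l m => l = [0, N, x.n, tb, x.n, 1, tb, N, 0, B, 0, 0, 0, x₁₃, x₁₄, x₁₅,
      x₁₆, 0] ∧ m = lay (lay (fun a => x.encode.getD a 0) B mat) tb [])
      (Ex.of_wp (p := move 7 1)
        ⟨by simp only [BinOp.eval, List.getD_cons_succ, List.getD_cons_zero]; omega,
        by simp, rfl, rfl⟩) ?_
    rintro l m ⟨rfl, rfl⟩
    have hmat : IsMatrix x.n x.Dominates mat := hmat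
    refine (ex_tuples htb hmat hn (by omega)).mono le_rfl ?_
    rintro l m ⟨h1, h2, h3, h4, rfl⟩
    exact ⟨h1, h2, h3, h4, _, rfl⟩
  · have h1 : N * (3 + (x.n * (3 + (9 * k + 1 + 7) + 1) + 1 + 3) + 1) =
        N * (x.n * (9 * k + 12) + 8) := by ring
    omega

end WordRAM

/-! ### Correctness of the reductions -/

namespace WordRAM

theorem digitList_length (n k i : ℕ) : (digitList n k i).length = k := by
  induction k generalizing i with
  | zero => rfl
  | succ k ih => simp [digitList, ih]

theorem digitList_lt {n : ℕ} (hn : 0 < n) (k i : ℕ) : ∀ d ∈ digitList n k i, d < n := by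
  induction k generalizing i with
  | zero => simp [digitList]
  | succ k ih =>
    intro d hd
    rcases List.mem_cons.1 hd with rfl | hd
    · exact Nat.mod_lt _ hn
    · exact ih _ d hd

/-- The list is read as a base-`n` expansion, least significant digit first. Hence counting up to `n
^ k` runs through all `k`-tuples of vertices. -/
theorem exists_digitList_eq {n : ℕ} (L : List ℕ) (hL : ∀ d ∈ L, d < n) :
    ∃ i < n ^ L.length, digitList n L.length i = L := by
  induction L with
  | nil => exact ⟨0, by simp, rfl⟩
  | cons d L ih =>
    obtain ⟨i, hi, h⟩ := ih fun d hd => hL d (by simp [hd])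
    have hd := hL d (by simp)
    refine ⟨d + n * i, ?_, ?_⟩
    · have : n * (i + 1) ≤ n * n ^ L.length := Nat.mul_le_mul_left n hi
      rw [List.length_cons, pow_succ, mul_comm _ n]
      rw [mul_add, mul_one] at this
      omega
    · rw [List.length_cons, digitList, Nat.add_mul_mod_self_left, Nat.mod_eq_of_lt hd,
        Nat.add_mul_div_left _ _ (by omega), Nat.div_eq_of_lt hd, zero_add, h]

theorem dominates_iff {x : GraphInput} (u v : Fin x.n) :
    x.Dominates u v ↔ v = u ∨ x.graph.Adj v u := by
  rw [GraphInput.Dominates, GraphInput.graph, SimpleGraph.fromEdgeSet_adj]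
  constructor
  · rintro (h | ⟨e, he, h⟩)
    · exact .inl (Fin.ext h.symm)
    · by_cases huv : v = u
      · exact .inl huv
      · refine .inr ⟨?_, huv⟩
        refine List.mem_map.2 ⟨e, he, ?_⟩
        rcases h with ⟨h1, h2⟩ | ⟨h1, h2⟩
        · rw [← Fin.ext h1, ← Fin.ext h2, Sym2.eq_swap]
        · rw [← Fin.ext h1, ← Fin.ext h2]
  · rintro (h | ⟨h, -⟩)
    · exact .inl (by rw [h])
    · obtain ⟨e, he, h⟩ := List.mem_map.1 h
      rcases Sym2.eq_iff.1 h with ⟨rfl, rfl⟩ | ⟨rfl, rfl⟩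
      · exact .inr ⟨e, he, .inr ⟨rfl, rfl⟩⟩
      · exact .inr ⟨e, he, .inl ⟨rfl, rfl⟩⟩

-- Orthogonality says that each vertex is dominated by a member of one of the two tuples. Tuples may
-- repeat or share vertices, so their union has at most `2 * k` elements; it is enlarged to exactly
-- that size, and supersets of dominating sets dominate. Conversely, a dominating set is listed and
-- cut in the middle.
open Classical in
theorem exists_dominatingSet_iff {x : GraphInput} {k : ℕ} (hn : 0 < x.n) (hk : 2 * k ≤ x.n) :
    (∃ i < x.n ^ k, ∃ j < x.n ^ k, ∀ c < x.n, ¬ (undominated x.n k x.Dominates i c ∧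
      undominated x.n k x.Dominates j c)) ↔
    ∃ S : Finset (Fin x.n), S.card = 2 * k ∧ IsDominatingSet x.graph S := by
  have hund : ∀ i c, ¬ (undominated x.n k x.Dominates i c : Prop) ↔
      ∃ d ∈ digitList x.n k i, x.Dominates d c := by
    intro i c
    simp [undominated]
  simp only [not_and_or, hund]
  constructor
  · rintro ⟨i, -, j, -, h⟩
    let S : Finset (Fin x.n) := Finset.univ.filter fun v =>
      v.val ∈ digitList x.n k i ++ digitList x.n k j
    have hS : S.card ≤ 2 * k := by
      have h1 : S.card ≤ (digitList x.n k i ++ digitList x.n k j).toFinset.card := by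
        refine Finset.card_le_card_of_injOn (fun v => v.val) (fun v hv => ?_)
          (fun a _ b _ hab => Fin.ext hab)
        simpa [S] using hv
      refine h1.trans ((List.toFinset_card_le _).trans ?_)
      rw [List.length_append, digitList_length, digitList_length]
      omega
    obtain ⟨S', hSS', hcard⟩ := Finset.exists_superset_card_eq hS (by simpa using hk)
    refine ⟨S', hcard, fun v => ?_⟩
    have hd : ∃ d : Fin x.n, d ∈ S ∧ x.Dominates d v := by
      rcases h v v.2 with ⟨d, hd, h⟩ | ⟨d, hd, h⟩
      · exact ⟨⟨d, digitList_lt hn k i d hd⟩, by simp [S, hd], h⟩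
      · exact ⟨⟨d, digitList_lt hn k j d hd⟩, by simp [S, hd], h⟩
    obtain ⟨d, hd, h⟩ := hd
    rcases (dominates_iff d v).1 h with rfl | h
    · exact .inl (hSS' hd)
    · exact .inr ⟨d, hSS' hd, h⟩
  · rintro ⟨S, hcard, hS⟩
    obtain ⟨L, hLdef⟩ : ∃ L, L = S.toList.map fun v : Fin x.n => v.val := ⟨_, rfl⟩
    have hlen : L.length = 2 * k := by simp [hLdef, hcard]
    have hlt : ∀ d ∈ L, d < x.n := by
      intro d hd
      rw [hLdef] at hd
      obtain ⟨v, -, rfl⟩ := List.mem_map.1 hd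
      exact v.2
    obtain ⟨i, hi, hiL⟩ := exists_digitList_eq (n := x.n) (L.take k)
      fun d hd => hlt d (List.mem_of_mem_take hd)
    obtain ⟨j, hj, hjL⟩ := exists_digitList_eq (n := x.n) (L.drop k)
      fun d hd => hlt d (List.mem_of_mem_drop hd)
    rw [List.length_take, hlen, min_eq_left (by omega)] at hi hiL
    rw [List.length_drop, hlen, show 2 * k - k = k by omega] at hj hjL
    refine ⟨i, hi, j, hj, fun c hc => ?_⟩
    have hd : ∃ d ∈ L, x.Dominates d c := by
      rcases hS ⟨c, hc⟩ with h | ⟨u, hu, h⟩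
      · exact ⟨c, by rw [hLdef]; exact List.mem_map.2 ⟨⟨c, hc⟩, by simpa using h, rfl⟩, .inl rfl⟩
      · exact ⟨u, by rw [hLdef]; exact List.mem_map.2 ⟨u, by simpa using hu, rfl⟩,
          (dominates_iff u ⟨c, hc⟩).2 (.inr h)⟩
    obtain ⟨d, hd, h⟩ := hd
    rw [← List.take_append_drop k L, List.mem_append, ← hiL, ← hjL] at hd
    rcases hd with hd | hd
    · exact .inl ⟨d, hd, h⟩
    · exact .inr ⟨d, hd, h⟩

/-- Each literal belongs to one half of the variables, so the combined assignment violates a clause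
exactly when both halves leave it unsatisfied. Bits without a variable behind them are set to false.
-/
theorem satisfiable_iff {x : CNFInput} {h : ℕ} (hh : x.n ≤ 2 * h) :
    (∃ i < 2 ^ h, ∃ j < 2 ^ h, ∀ c < x.m, ¬ (leftUnsat x h i c ∧ rightUnsat x h j c)) ↔
      x.Satisfiable := by
  have key : ∀ i j, (∀ c < x.m, ¬ (leftUnsat x h i c ∧ rightUnsat x h j c)) ↔
      ∀ cl ∈ x.clauses, ∃ l ∈ cl, (l.1.val < h ∧ i.testBit l.1 = l.2) ∨
        (¬ l.1.val < h ∧ j.testBit (l.1 - h) = l.2) := by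
    intro i j
    rw [List.forall_mem_iff_getElem]
    refine forall_congr' fun c => forall_congr' fun hc => ?_
    have hc' : c < x.clauses.length := hc
    rw [leftUnsat, rightUnsat, List.getD_eq_getElem _ _ hc', leftSat, rightSat, not_and_or]
    simp only [Bool.not_eq_true', Bool.not_eq_false, List.any_eq_true, Bool.and_eq_true,
      decide_eq_true_eq, beq_iff_eq, decide_eq_false_iff_not, ← exists_or, ← and_or_left]
    exact Iff.rfl
  simp only [key]
  constructor
  · rintro ⟨i, -, j, -, H⟩
    refine ⟨fun v => if v.val < h then i.testBit v else j.testBit (v - h), fun cl hcl => ?_⟩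
    obtain ⟨l, hl, h1 | h1⟩ := H cl hcl
    · exact ⟨l, hl, by dsimp only; rw [if_pos h1.1, h1.2]⟩
    · exact ⟨l, hl, by dsimp only; rw [if_neg h1.1, h1.2]⟩
  · rintro ⟨a, ha⟩
    refine ⟨Nat.ofBits fun v : Fin h => if hv : v.val < x.n then a ⟨v, hv⟩ else false,
      Nat.ofBits_lt_two_pow _,
      Nat.ofBits fun v : Fin h => if hv : h + v.val < x.n then a ⟨h + v, hv⟩ else false,
      Nat.ofBits_lt_two_pow _, fun cl hcl => ?_⟩
    obtain ⟨l, hl, h1⟩ := ha cl hcl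
    refine ⟨l, hl, ?_⟩
    by_cases hlh : l.1.val < h
    · refine .inl ⟨hlh, ?_⟩
      rw [Nat.testBit_ofBits_lt _ _ hlh]
      simp [h1]
    · refine .inr ⟨hlh, ?_⟩
      have := l.1.2
      rw [Nat.testBit_ofBits_lt _ _ (by omega)]
      have hsub : h + (l.1.val - h) = l.1.val := by omega
      simp [hsub, h1]

end WordRAM

namespace WordRAM

/-! ### The algorithms -/

/-- The program for the `2 * k`-dominating set problem, using the program `P` for the diameter. -/
def domProg (k : ℕ) (P : Prog) : Prog :=
  .seq (block [.const 5 1, .load 4 0, .const 15 (2 * k), .op .lt 15 4 15])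
    (.branch 15 .skip (.seq (domTable k) (vectorProg P)))

/-- Running time of `domProg`, where `M` bounds the resources of the program for the diameter. -/
def domTime (M : ℕ → ℕ) (k n : ℕ) : ℕ :=
  100 + 3 * k + 25 * n + 17 * (n * n) + n ^ k * (n * (9 * k + 32) + 28) +
    2 * M (1 + 2 * n + 2 * n ^ k + 2 * (n ^ k * n))

/-- The program for satisfiability, using the program `P` for the diameter. -/
def satProg (P : Prog) : Prog := .seq satTable (vectorProg P)

/-- Running time of `satProg`, where `M` bounds the resources of the program for the diameter. -/
def satTime (M : ℕ → ℕ) (n m : ℕ) : ℕ :=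
  100 + 2 * n + 22 * m + (2 * n + 1) * m +
    2 ^ ((n + 1) / 2) * (m * (42 * n + 33) + 28) +
    2 * M (1 + 2 * m + 2 * 2 ^ ((n + 1) / 2) + 2 * (2 ^ ((n + 1) / 2) * m))

theorem _root_.GraphInput.m_le (x : GraphInput) : x.m ≤ x.n * x.n := by
  have := (List.Nodup.of_map _ x.nodup).length_le_card
  simpa [GraphInput.m] using this

theorem solves_domProg {P : Prog} {T M : ℕ → ℕ}
    (hP : Solves P GraphInput.encode (fun x => x.graph.ediam = 2 ∨ x.graph.ediam = 3)
      (fun x => x.graph.ediam = 3) fun x => T x.m)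
    (hM : ∀ B, ∀ k ≤ B, 2 + 2 * k + T k ≤ M B) {k : ℕ} (hk : 1 ≤ k) :
    Solves (domProg k P) GraphInput.encode (fun _ => True)
      (fun x => ∃ S : Finset (Fin x.n), S.card = 2 * k ∧ IsDominatingSet x.graph S)
      (fun x => domTime M k x.n) := by
  classical
  obtain ⟨c, hP⟩ := hP
  refine ⟨c + 1, fun x _ => ?_⟩
  obtain ⟨X, hX⟩ : ∃ X, X = x.encode.length + domTime M k x.n := ⟨_, rfl⟩
  rw [← hX, init_eq_st]
  dsimp only
  have hT := x.encode_length
  obtain ⟨N, hN⟩ : ∃ N, N = x.n ^ k := ⟨_, rfl⟩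
  have htime : domTime M k x.n = 100 + 3 * k + 25 * x.n + 17 * (x.n * x.n) +
      (N * (x.n * (9 * k + 12) + 8) + 20 * (N * x.n) + 20 * N) +
      2 * M (1 + 2 * x.n + 2 * N + 2 * (N * x.n)) := by rw [domTime, ← hN]; ring
  rw [htime] at hX ⊢
  have hm := x.m_le
  -- The summand `3 * k` of `domTime` makes the constant `2 * k` fit into a word.
  have hY : 2 * k + 3 ≤ X := by omega
  have hn1 : x.n ≤ X := by omega
  have hbound := fun a ha => (word_bound (c := c) (Y := 0) (a := a) (X := X) (Nat.zero_le _) ha).1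
  have hw1 := hbound _ hY
  have hw2 := hbound _ hn1
  have h0 : x.encode.getD 0 0 = x.n := rfl
  have hpre : Ex ((c + 1) * (Nat.log 2 X + 1))
      (block [.const 5 1, .load 4 0, .const 15 (2 * k), .op .lt 15 4 15]) (List.replicate 18 0)
      (fun a => x.encode.getD a 0) 5 fun l m =>
        l = [0, 0, 0, 0, x.n, 1, 0, 0, 0, 0, 0, 0, 0, 0, 0, if x.n < 2 * k then 1 else 0, 0, 0] ∧
        m = fun a => x.encode.getD a 0 := by
    refine (Ex.of_wp ?_).mono (T := 5) (by decide) fun _ _ h => h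
    simp only [block, wp, BinOp.eval, List.replicate, List.getD_cons_succ,
      List.getD_cons_zero, List.set_cons_succ, List.set_cons_zero, List.length_cons,
      List.length_nil, h0]
    and_intros
    any_goals omega
    · split <;> omega
  obtain ⟨t₁, l₁, m₁, ht₁, he₁, rfl, rfl⟩ := hpre
  -- With too few vertices there is no set of the required size, and register 0 still holds the
  -- answer 0. Otherwise `1 ≤ k` makes `n` positive.
  by_cases hnk : x.n < 2 * k
  · rw [if_pos hnk] at he₁
    refine ⟨t₁ + (1 + 1), _, by omega,
      .seq he₁ (.branch_true _ (by simp [st]) (.skip _)), ?_, fun _ => by simp [st]⟩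
    rintro ⟨S, hS, -⟩
    have := S.card_le_univ
    rw [Fintype.card_fin] at this
    omega
  · rw [if_neg hnk] at he₁
    have hn : 0 < x.n := by omega
    obtain ⟨tb, htb⟩ : ∃ tb, tb = 2 + 2 * x.m + x.n * x.n := ⟨_, rfl⟩
    obtain ⟨t₂, l₂, m₂, ht₂, he₂, hl, h1, h2, h3, low, rfl⟩ :=
      ex_domTable (w := (c + 1) * (Nat.log 2 X + 1)) (k := k) (z₁₅ := 0) htb hN hn
        (hbound _ (by omega))
    obtain ⟨t₃, s, ht₃, he₃, hyes, hno⟩ := exec_vectorProg hP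
      (isTable_flatMap N x.n (undominated x.n k x.Dominates) (undominated x.n k x.Dominates))
      (by rw [hN]; positivity) (hM (1 + 2 * x.n + 2 * N + 2 * (N * x.n)))
      (tb := tb) (X := X) (by omega) hl h1 h2 h3 low
    rw [hN, exists_dominatingSet_iff hn (by omega)] at hyes hno
    refine ⟨t₁ + (t₂ + t₃ + 1), s, by omega,
      .seq he₁ (.branch_false _ (by simp [st]) (.seq he₂ he₃)), hyes, hno⟩

theorem solves_satProg {P : Prog} {T M : ℕ → ℕ}
    (hP : Solves P GraphInput.encode (fun x => x.graph.ediam = 2 ∨ x.graph.ediam = 3)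
      (fun x => x.graph.ediam = 3) fun x => T x.m)
    (hM : ∀ B, ∀ k ≤ B, 2 + 2 * k + T k ≤ M B) (K : CNFInput → Prop) :
    Solves (satProg P) CNFInput.encode K CNFInput.Satisfiable (fun x => satTime M x.n x.m) := by
  obtain ⟨c, hP⟩ := hP
  refine ⟨c + 1, fun x _ => ?_⟩
  obtain ⟨X, hX⟩ : ∃ X, X = x.encode.length + satTime M x.n x.m := ⟨_, rfl⟩
  rw [← hX, init_eq_st]
  dsimp only
  obtain ⟨N, hN⟩ : ∃ N, N = 2 ^ ((x.n + 1) / 2) := ⟨_, rfl⟩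
  have htime : satTime M x.n x.m = 100 + 2 * x.n + 22 * x.m + (2 * x.n + 1) * x.m +
      (N * (x.m * (42 * x.n + 13) + 8) + 20 * (N * x.m) + 20 * N) +
      2 * M (1 + 2 * x.m + 2 * N + 2 * (N * x.m)) := by rw [satTime, ← hN]; ring
  rw [htime] at hX ⊢
  have hbound := fun a ha => (word_bound (c := c) (Y := 0) (a := a) (X := X) (Nat.zero_le _) ha).1
  obtain ⟨tb, htb⟩ : ∃ tb, tb = (2 * x.n + 1) * x.m + 2 := ⟨_, rfl⟩
  obtain ⟨t₂, l₂, m₂, ht₂, he₂, hl, h1, h2, h3, rfl⟩ :=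
    ex_satTable (w := (c + 1) * (Nat.log 2 X + 1)) htb hN (hbound _ (by omega))
  obtain ⟨t₃, s, ht₃, he₃, hyes, hno⟩ := exec_vectorProg hP
    (isTable_flatMap N x.m (leftUnsat x ((x.n + 1) / 2)) (rightUnsat x ((x.n + 1) / 2)))
    (by rw [hN]; positivity) (hM (1 + 2 * x.m + 2 * N + 2 * (N * x.m)))
    (tb := tb) (X := X) (by omega) hl h1 h2 h3 (fun a => x.encode.getD a 0)
  rw [hN, satisfiable_iff (by omega)] at hyes hno
  exact ⟨t₂ + t₃, s, by omega, .seq he₂ he₃, hyes, hno⟩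

end WordRAM

open WordRAM

/-! ### Running times -/

/-- The asymptotic bound says nothing about small `m`. With `m + 1` as base the comparison function
is positive everywhere, and one constant serves all `m`. -/
theorem exists_bound_of_isBigO {T : ℕ → ℕ} {a : ℝ} (ha : 0 ≤ a)
    (h : (fun m => (T m : ℝ)) =O[atTop] fun m : ℕ => (m : ℝ) ^ a) :
    ∃ C : ℝ, 0 < C ∧ ∀ m, (T m : ℝ) ≤ C * ((m : ℝ) + 1) ^ a := by
  have h1 : (fun m => (T m : ℝ)) =O[atTop] fun m : ℕ => ((m : ℝ) + 1) ^ a := by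
    refine h.trans (IsBigO.of_bound 1 (Eventually.of_forall fun m => ?_))
    rw [one_mul, Real.norm_of_nonneg (by positivity), Real.norm_of_nonneg (by positivity)]
    gcongr
    linarith
  obtain ⟨C, hC, hb⟩ := bound_of_isBigO_nat_atTop h1
  refine ⟨C, hC, fun m => ?_⟩
  have := hb (x := m) (by positivity)
  rwa [Real.norm_of_nonneg (by positivity), Real.norm_of_nonneg (by positivity)] at this

/-- A bound for the words and the steps used on graphs with at most `B` edges. -/
noncomputable def resourceBound (C a : ℝ) (B : ℕ) : ℕ := 2 + 2 * B + ⌈C * ((B : ℝ) + 1) ^ a⌉₊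

theorem le_resourceBound {T : ℕ → ℕ} {C a : ℝ} (ha : 0 ≤ a) (hC : 0 < C)
    (hT : ∀ m, (T m : ℝ) ≤ C * ((m : ℝ) + 1) ^ a) (B k : ℕ) (hk : k ≤ B) :
    2 + 2 * k + T k ≤ resourceBound C a B := by
  have h1 : T k ≤ ⌈C * ((B : ℝ) + 1) ^ a⌉₊ := by
    refine Nat.cast_le.1 (((hT k).trans ?_).trans (Nat.le_ceil _))
    have : (k : ℝ) ≤ B := by exact_mod_cast hk
    gcongr
  rw [resourceBound]
  omega

theorem resourceBound_le {C a y : ℝ} (ha : 0 ≤ a) (hC : 0 < C) {B : ℕ} (hB : (B : ℝ) + 1 ≤ y) :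
    (resourceBound C a B : ℝ) ≤ 3 + 2 * y + C * y ^ a := by
  rw [resourceBound]
  push_cast
  have h1 : C * ((B : ℝ) + 1) ^ a ≤ C * y ^ a := by gcongr
  have h2 := (Nat.ceil_lt_add_one (a := C * ((B : ℝ) + 1) ^ a) (by positivity)).le
  linarith

/-- Writing the table and the graph takes time O(Y) with `Y = n ^ (k + 1)`, and the graph has fewer
than `8 * Y` edges. The exponent of the diameter computation is `(k + 1) * (2 - ε)`, which is at
most `2 * k - ε` precisely because `2 ≤ k * ε`. -/
theorem domTime_isBigO {C ε : ℝ} (hC : 0 < C) (hε : ε ≤ 1) {k : ℕ} (hk : 2 ≤ k)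
    (hkε : 2 ≤ k * ε) :
    (fun n => (domTime (resourceBound C (2 - ε)) k n : ℝ)) =O[atTop]
      fun n : ℕ => (n : ℝ) ^ (2 * (k : ℝ) - ε) := by
  refine IsBigO.of_bound (100 + 3 * k + 25 + 17 + (9 * k + 32) + 28 + 6 + 4 * 8 +
    2 * C * 8 ^ (2 - ε)) ?_
  filter_upwards [eventually_ge_atTop 1] with n hn
  have hn' : (1 : ℝ) ≤ n := by exact_mod_cast hn
  have hk' : (2 : ℝ) ≤ k := by exact_mod_cast hk
  rw [Real.norm_of_nonneg (by positivity), Real.norm_of_nonneg (by positivity)]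
  set Z : ℝ := (n : ℝ) ^ (2 * (k : ℝ) - ε) with hZ
  obtain ⟨Y, hY⟩ : ∃ Y : ℝ, Y = (n : ℝ) ^ k * n := ⟨_, rfl⟩
  have hYpow : Y = (n : ℝ) ^ ((k : ℝ) + 1) := by
    rw [hY, ← pow_succ, ← Real.rpow_natCast]
    push_cast
    rfl
  have hNk : (n : ℝ) ≤ (n : ℝ) ^ k := le_self_pow₀ hn' (by omega)
  have hN1 : (1 : ℝ) ≤ (n : ℝ) ^ k := hn'.trans hNk
  have h1Y : 1 ≤ Y := by rw [hY]; nlinarith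
  have hnY : (n : ℝ) ≤ Y := by rw [hY]; nlinarith
  have hn2Y : (n : ℝ) * n ≤ Y := by rw [hY]; gcongr
  have hNY : (n : ℝ) ^ k ≤ Y := by rw [hY]; nlinarith
  -- Here `k + 1 ≤ 2 * k - ε`, by `2 ≤ k` and `ε ≤ 1`.
  have hYZ : Y ≤ Z := by
    rw [hYpow, hZ]
    exact Real.rpow_le_rpow_of_exponent_le hn' (by linarith)
  have hY2 : (8 * Y) ^ (2 - ε) ≤ 8 ^ (2 - ε) * Z := by
    rw [Real.mul_rpow (by norm_num) (by linarith), hYpow, hZ, ← Real.rpow_mul (by linarith)]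
    gcongr
    · nlinarith
  have hM := resourceBound_le (C := C) (a := 2 - ε) (y := 8 * Y) (by linarith) hC
    (B := 1 + 2 * n + 2 * n ^ k + 2 * (n ^ k * n)) (by push_cast; rw [← hY]; linarith)
  have hCZ : C * (8 * Y) ^ (2 - ε) ≤ C * (8 ^ (2 - ε) * Z) := by gcongr
  rw [domTime]
  push_cast
  have hexp : (n : ℝ) ^ k * (n * (9 * k + 32) + 28) = Y * (9 * k + 32) + 28 * (n : ℝ) ^ k := by
    rw [hY]; ring
  rw [hexp]
  have hkY : (k : ℝ) * 1 ≤ k * Y := by gcongr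
  have hkZ : (k : ℝ) * Y ≤ k * Z := by gcongr
  nlinarith

theorem satTime_le {C ε : ℝ} (hC : 0 < C) (hε0 : 0 < ε) (hε : ε ≤ 1) (n m : ℕ) :
    (satTime (resourceBound C (2 - ε)) n m : ℝ) ≤
      (1000 + 2 * C * 128) * (2 : ℝ) ^ ((1 - ε ^ 2 / 4) * n) * ((n : ℝ) + m + 1) ^ 2 := by
  obtain ⟨N, hN⟩ : ∃ N : ℕ, N = 2 ^ ((n + 1) / 2) := ⟨_, rfl⟩
  set Z : ℝ := (2 : ℝ) ^ ((1 - ε ^ 2 / 4) * n) with hZ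
  set s : ℝ := (n : ℝ) + m + 1 with hs
  have hn0 : (0 : ℝ) ≤ n := n.cast_nonneg
  have hm0 : (0 : ℝ) ≤ m := m.cast_nonneg
  have hs1 : 1 ≤ s := by linarith
  have hN1 : (1 : ℝ) ≤ N := by
    rw [hN]; exact_mod_cast Nat.one_le_two_pow
  have hNle : (N : ℝ) ≤ (2 : ℝ) ^ (((n : ℝ) + 1) / 2) := by
    rw [hN]
    push_cast
    rw [← Real.rpow_natCast]
    refine Real.rpow_le_rpow_of_exponent_le (by norm_num) ?_
    exact_mod_cast Nat.cast_div_le (α := ℝ) (m := n + 1) (n := 2)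
  have hNZ : (N : ℝ) ≤ 2 * Z := by
    refine hNle.trans ?_
    rw [hZ, show (2 : ℝ) * 2 ^ ((1 - ε ^ 2 / 4) * n) = 2 ^ (1 + (1 - ε ^ 2 / 4) * n) by
      rw [Real.rpow_add (by norm_num), Real.rpow_one]]
    refine Real.rpow_le_rpow_of_exponent_le (by norm_num) ?_
    have hε2 : ε ^ 2 ≤ 1 := pow_le_one₀ hε0.le hε
    nlinarith [mul_nonneg hn0 (sub_nonneg.2 hε2)]
  -- The exponent is about `n * (1 - ε / 2)`, and `ε ^ 2 / 4 ≤ ε / 2`. Rounding `n / 2` up to an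
  -- integer costs at most a factor 2.
  have hNpow : (N : ℝ) ^ (2 - ε) ≤ 2 * Z := by
    calc (N : ℝ) ^ (2 - ε) ≤ ((2 : ℝ) ^ (((n : ℝ) + 1) / 2)) ^ (2 - ε) := by
          gcongr
          linarith
      _ = (2 : ℝ) ^ (((n : ℝ) + 1) / 2 * (2 - ε)) := by rw [← Real.rpow_mul (by norm_num)]
      _ ≤ 2 ^ (1 + (1 - ε ^ 2 / 4) * n) := by
          refine Real.rpow_le_rpow_of_exponent_le (by norm_num) ?_
          nlinarith [mul_nonneg hn0 hε0.le, mul_nonneg (mul_nonneg hn0 hε0.le) (sub_nonneg.2 hε)]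
      _ = 2 * Z := by rw [Real.rpow_add (by norm_num), Real.rpow_one]
  have hpow2 : ∀ y : ℝ, 1 ≤ y → y ^ (2 - ε) ≤ y ^ 2 := fun y hy => by
    rw [← Real.rpow_natCast y 2]
    exact Real.rpow_le_rpow_of_exponent_le hy (by push_cast; linarith)
  -- The constant is `8 ^ 2 * 2`: for the bases 8 and `s`, which are at least 1, the exponent is
  -- raised to 2, and the factor 2 comes from `hNpow`.
  have hy : (8 * N * s) ^ (2 - ε) ≤ 128 * (Z * s ^ 2) := by
    have h8 := hpow2 8 (by norm_num)
    have hss := hpow2 s hs1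
    rw [Real.mul_rpow (by positivity) (by positivity), Real.mul_rpow (by norm_num) (by positivity)]
    calc (8 : ℝ) ^ (2 - ε) * (N : ℝ) ^ (2 - ε) * s ^ (2 - ε) ≤ 8 ^ 2 * (2 * Z) * s ^ 2 := by
          gcongr
      _ = 128 * (Z * s ^ 2) := by ring
  have hB : (((1 + 2 * m + 2 * N + 2 * (N * m) : ℕ) : ℝ)) + 1 ≤ 8 * N * s := by
    push_cast
    have h1 : (m : ℝ) ≤ N * m := by nlinarith
    have h2 : (N : ℝ) * n ≥ 0 := by positivity
    rw [hs]
    nlinarith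
  have hM := resourceBound_le (C := C) (a := 2 - ε) (by linarith) hC hB
  have hCy : C * (8 * N * s) ^ (2 - ε) ≤ C * (128 * (Z * s ^ 2)) := by gcongr
  rw [satTime, ← hN]
  push_cast at hM ⊢
  have hns : (n : ℝ) ≤ s := by linarith
  have hms : (m : ℝ) ≤ s := by linarith
  have hss : s ≤ s ^ 2 := by nlinarith
  have hmn : (m : ℝ) * n ≤ s ^ 2 := by nlinarith
  have hrest : 100 + 2 * (n : ℝ) + 22 * m + (2 * n + 1) * m + N * (m * (42 * n + 33) + 28) +
      2 * (3 + 2 * (8 * N * s)) ≤ 500 * (N * s ^ 2) := by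
    have h1 : 100 + 2 * (n : ℝ) + 22 * m + (2 * n + 1) * m + 6 ≤ 140 * s ^ 2 := by nlinarith
    have h2 : (m : ℝ) * (42 * n + 33) + 28 + 32 * s ≤ 140 * s ^ 2 := by nlinarith
    have h3 : s ^ 2 ≤ N * s ^ 2 := by nlinarith
    nlinarith
  have hNs : (N : ℝ) * s ^ 2 ≤ 2 * Z * s ^ 2 := by gcongr
  nlinarith

/-- The running time would be o(m), against the lower bound `m - 1` of
`linear_le_of_solves_diameter`. -/
theorem not_diameterTwoVsThreeInTime {ε : ℝ} (hε : 1 < ε) :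
    ¬ DiameterTwoVsThreeInTime fun m => (m : ℝ) ^ (2 - ε) := by
  rintro ⟨P, T, hT, hP⟩
  have h1 : (fun m : ℕ => (m : ℝ) ^ (2 - ε)) =o[atTop] fun m : ℕ => (m : ℝ) := by
    have h0 : (fun y : ℝ => y ^ (2 - ε)) =o[atTop] fun y : ℝ => y := by
      refine (isLittleO_iff_tendsto' ?_).2 ?_
      · filter_upwards [eventually_gt_atTop 0] with y hy h
        exact absurd h hy.ne'
      · refine (tendsto_rpow_neg_atTop (y := ε - 1) (by linarith)).congr' ?_
        filter_upwards [eventually_gt_atTop 0] with y hy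
        rw [show -(ε - 1) = 2 - ε - 1 by ring, Real.rpow_sub_one hy.ne']
    exact h0.comp_tendsto tendsto_natCast_atTop_atTop
  have h2 := (hT.trans_isLittleO h1).def (c := 1 / 2) (by norm_num)
  obtain ⟨m, hm, hm3⟩ := (h2.and (eventually_ge_atTop 3)).exists
  have h3 := linear_le_of_solves_diameter hP hm3
  rw [Real.norm_of_nonneg (by positivity), Real.norm_of_nonneg (by positivity)] at hm
  have h4 : (m : ℝ) ≤ T m + 1 := by exact_mod_cast h3
  have h5 : (3 : ℝ) ≤ m := by exact_mod_cast hm3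
  linarith

theorem mainTheorem1 (ε : ℝ) (hε : 0 < ε)
    (h : DiameterTwoVsThreeInTime fun m => (m : ℝ) ^ (2 - ε)) :
    (∀ k : ℕ, 2 / ε ≤ (k : ℝ) →
      DominatingSetInTime (2 * k) fun n => (n : ℝ) ^ (2 * (k : ℝ) - ε)) ∧
    SatInTime (fun _ => True) (1 - ε ^ 2 / 4) ∧
    ¬ SETH := by
  have hε1 : ε ≤ 1 := by
    by_contra! h1
    exact not_diameterTwoVsThreeInTime h1 h
  obtain ⟨P, T, hT, hP⟩ := h
  obtain ⟨C, hC, hTC⟩ := exists_bound_of_isBigO (by linarith) hT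
  have hM := le_resourceBound (by linarith) hC hTC
  have hsat : ∀ K, SatInTime K (1 - ε ^ 2 / 4) := fun K =>
    ⟨satProg P, satTime (resourceBound C (2 - ε)),
      ⟨_, 2, fun n m => satTime_le hC hε hε1 n m⟩, solves_satProg hP hM K⟩
  refine ⟨fun k hk => ?_, hsat _, fun hseth => ?_⟩
  · have hkε : 2 ≤ k * ε := (div_le_iff₀ hε).1 hk
    have hk2 : 2 ≤ k := by
      have : (2 : ℝ) ≤ k := by nlinarith [(k.cast_nonneg : (0 : ℝ) ≤ k)]
      exact_mod_cast this
    exact ⟨domProg k P, domTime (resourceBound C (2 - ε)) k, domTime_isBigO hC hε1 hk2 hkε,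
      solves_domProg hP hM (by omega)⟩
  -- One program serves all clause widths, so the numbers `s_r` stay below a constant smaller than
  -- 1. The set defining `s_r` contains only nonnegative exponents; `1 - ε ^ 2 / 4` is one by `ε ≤
  -- 1`.
  · have hle : ∀ r, satExponent r ≤ 1 - ε ^ 2 / 4 := fun r =>
      csInf_le ⟨0, fun δ hδ => hδ.1⟩ ⟨by nlinarith, hsat _⟩
    have := le_of_tendsto' hseth hle
    nlinarith
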